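/- **Setting.** Let $n,p,k\ge 1$ and $n_o\ge 0$ be integers with $n\le p$ and $k<p$. Let $\beta^*\in\mathbb{R}^p$ have at most $k$ nonzero entries, and let $\Sigma_x\in\mathbb{R}^{p\times p}$ be a covariance matrix with smallest eigenvalue $\lambda_{\min}>0$ and largest eigenvalue $\lambda_{\max}$. Before corruption, the data matrix $X^0\in\mathbb{R}^{(n+n_o)\times p}$ has independent centred rows $x_i$ with covariance $\frac1n\Sigma_x$ and $\mathbb{E}\,e^{t\,u^\top x_i}\le e^{t^2\sigma_x^2/(2n)}$ for all $t\in\mathbb{R}$ and all unit vectors $u$. The response is $y^0=X^0\beta^*+\epsilon$, where the entries of $\epsilon$ are independent, $\epsilon_i$ is independent of $x_i$, and $\mathbb{E}\,e^{t\epsilon_i}\le e^{t^2\sigma_\epsilon^2/(2n)}$. We observe $(X,y)$, obtained from $(X^0,y^0)$ by changing at most $n_o$ rows of $X^0$ and at most $n_o$ entries of $y^0$ in an arbitrary (possibly data-dependent) way. For vectors $u,v\in\mathbb{R}^{n+n_o}$ let $\langle u,v\rangle_{n_o}$ be the sum of the products $u_iv_i$ after the $n_o$ products largest in absolute value have been discarded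 (ties are broken by a fixed rule). For $\alpha\in[0,1]$ put $$\hat\Gamma_{ab}=\alpha\langle X_a,X_b\rangle_{n_o}+(1-\alpha)\mathbf 1_{a=b},\qquad \hat g_a=\langle X_a,y\rangle_{n_o},$$ where $X_a$ is the $a$-th column of $X$. Let $R=\|\beta^*\|_1$, let $\hat\beta$ be any minimizer of $\frac12\beta^\top\hat\Gamma\beta-\langle\hat g,\beta\rangle$ over $\{\|\beta\|_1\le R\}$, and let $(\beta^t)_{t\ge0}$ be generated by projected gradient descent $$\beta^{t+1}=\Pi_{\{\|\cdot\|_1\le R\}}\Big(\beta^t-\frac1\eta(\hat\Gamma\beta^t-\hat g)\Big),\qquad \eta=2\mu_2,\quad \mu_2=\frac{3\alpha}{2}\lambda_{\max}+(1-\alpha),$$ from any feasible $\beta^0$ (that is, $\|\beta^0\|_1\le R$); here $\Pi$ is the Euclidean projection. **Theorem 2 (optimization error bound).** For every constant $d\in\mathbb{N}$ there are constants $C,c,c_1>0$, depending only on $d$, and for all $\alpha\in[0,1]$ and $0<\lambda_{\min}\le\lambda_{\max}$ there is $\gamma\in(0,1)$, depending only on $d$, $\alpha$, $\lambda_{\min}$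 and $\lambda_{\max}$, such that the following holds in the above setting. If $$n\ge C\,\frac{\sigma_x^4}{\lambda_{\min}^2}\,k\log p,\qquad \frac{n_o}{n}\le c\,\frac{\lambda_{\min}}{\sigma_x^2\,k\log p},$$ and every column of $\Sigma_x$ has at most $d$ nonzero entries, then, with probability at least $1-p^{-2}$, for all such $\hat\beta$ and $(\beta^t)$ and all $t\in\mathbb{N}$, $$\|\beta^t-\hat\beta\|_2^2\le\gamma^t\|\beta^0-\hat\beta\|_2^2+c_1\frac{\log p}{n}\|\hat\beta-\beta^*\|_1^2+\|\hat\beta-\beta^*\|_2^2,$$ $$\|\beta^t-\hat\beta\|_1\le2\sqrt k\,\|\beta^t-\hat\beta\|_2+2\sqrt k\,\|\hat\beta-\beta^*\|_2+2\|\hat\beta-\beta^*\|_1.$$ -/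

import Mathlib

open MeasureTheory ProbabilityTheory
open scoped NNReal Matrix

noncomputable section

namespace REN

/-- The `ℓ₁` norm on `ℝ^p`. -/
def l1Norm {p : ℕ} (v : Fin p → ℝ) : ℝ := ‖(WithLp.toLp 1 v : PiLp 1 (fun _ : Fin p => ℝ))‖

/-- The Euclidean norm on `ℝ^p`. -/
def l2Norm {p : ℕ} (v : Fin p → ℝ) : ℝ := ‖(WithLp.toLp 2 v : EuclideanSpace ℝ (Fin p))‖

/-- The closed `ℓ₁` ball of radius `R` in `ℝ^p`. -/
def l1Ball (p : ℕ) (R : ℝ) : Set (Fin p → ℝ) := {v | l1Norm v ≤ R}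

/-- A random `m × p` matrix is sub-Gaussian with parameter `(S, s)`: its rows are independent and
centred, each with covariance matrix `S`, and each one-dimensional projection of a row along a unit
vector has moment generating function at most `exp (s * t ^ 2 / 2)` (`s` is the square of the
sub-Gaussian parameter of a real random variable). -/
structure IsSubGaussianMatrix {Ω : Type*} [MeasurableSpace Ω] (P : Measure Ω) {m p : ℕ}
    (X : Ω → Matrix (Fin m) (Fin p) ℝ) (S : Matrix (Fin p) (Fin p) ℝ) (s : ℝ≥0) : Prop where
  measurable_row : ∀ i, Measurable (fun ω => X ω i)
  indep_rows : iIndepFun (fun i ω => X ω i) P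
  mean_zero : ∀ i a, ∫ ω, X ω i a ∂P = 0
  covariance_eq : ∀ i a b, cov[fun ω => X ω i a, fun ω => X ω i b; P] = S a b
  subGaussian : ∀ i (u : Fin p → ℝ), l2Norm u = 1 → HasSubgaussianMGF (fun ω => u ⬝ᵥ X ω i) s P

/-- The additive noise: independent sub-Gaussian entries with squared parameter `s`, the noise of
each sample being independent of the covariates of that sample. -/
structure IsSubGaussianNoise {Ω : Type*} [MeasurableSpace Ω] (P : Measure Ω) {m p : ℕ}
    (X : Ω → Matrix (Fin m) (Fin p) ℝ) (ε : Ω → Fin m → ℝ) (s : ℝ≥0) : Prop where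
  measurable_entry : ∀ i, Measurable (fun ω => ε ω i)
  indep_entries : iIndepFun (fun i ω => ε ω i) P
  subGaussian : ∀ i, HasSubgaussianMGF (fun ω => ε ω i) s P
  indep_covariate : ∀ i, IndepFun (fun ω => X ω i) (fun ω => ε ω i) P

/-- `A` is obtained from `B` by changing at most `r` of the entries of the family (rows, if the
family is a matrix) in an arbitrary way. -/
def IsCorruption {m : ℕ} {E : Type*} (r : ℕ) (B A : Fin m → E) : Prop :=
  {i | A i ≠ B i}.ncard ≤ r

/-- The trimmed inner product: the products `u i * v i` are sorted by increasing absolute value,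
the `h` largest ones in absolute value are discarded, and the remaining ones are summed. -/
def trimmedInner {m : ℕ} (h : ℕ) (u v : Fin m → ℝ) : ℝ :=
  ∑ l ∈ Finset.univ.filter (fun l : Fin m => (l : ℕ) + h < m),
    u (Tuple.sort (fun i => |u i * v i|) l) * v (Tuple.sort (fun i => |u i * v i|) l)

/-- The robust surrogate of the covariance matrix, `α ⟨X_a, X_b⟩_trimmed + (1 - α) I_ab`. -/
def GammaHat {m p : ℕ} (α : ℝ) (h : ℕ) (X : Matrix (Fin m) (Fin p) ℝ) :
    Matrix (Fin p) (Fin p) ℝ :=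
  Matrix.of fun a b =>
    α * trimmedInner h (fun i => X i a) (fun i => X i b)
      + (1 - α) * (1 : Matrix (Fin p) (Fin p) ℝ) a b

/-- The robust surrogate of the covariate-response correlation, `⟨X_a, y⟩_trimmed`. -/
def gammaHat {m p : ℕ} (h : ℕ) (X : Matrix (Fin m) (Fin p) ℝ) (y : Fin m → ℝ) : Fin p → ℝ :=
  fun a => trimmedInner h (fun i => X i a) y

/-- The quadratic loss `½ βᵀ Γ β - ⟨g, β⟩`. -/
def loss {p : ℕ} (Γ : Matrix (Fin p) (Fin p) ℝ) (g β : Fin p → ℝ) : ℝ :=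
  (1 / 2) * (β ⬝ᵥ (Γ *ᵥ β)) - g ⬝ᵥ β

/-- `b` is a global minimizer of the quadratic loss over the `ℓ₁` ball of radius `R`. -/
def IsSolution {p : ℕ} (Γ : Matrix (Fin p) (Fin p) ℝ) (g : Fin p → ℝ) (R : ℝ)
    (b : Fin p → ℝ) : Prop :=
  b ∈ l1Ball p R ∧ IsMinOn (loss Γ g) (l1Ball p R) b

/-- `z` is the Euclidean projection of `v` onto the `ℓ₁` ball of radius `R`. -/
def IsL1Projection {p : ℕ} (R : ℝ) (v z : Fin p → ℝ) : Prop :=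
  z ∈ l1Ball p R ∧ IsMinOn (fun w => l2Norm (v - w)) (l1Ball p R) z

/-- `β` is a run of projected gradient descent with step-size parameter `η` (the gradient is
multiplied by `1 / η`), started at a feasible point. -/
def IsProjGradDescent {p : ℕ} (Γ : Matrix (Fin p) (Fin p) ℝ) (g : Fin p → ℝ) (R η : ℝ)
    (β : ℕ → Fin p → ℝ) : Prop :=
  β 0 ∈ l1Ball p R ∧
    ∀ t, IsL1Projection R (β t - (1 / η) • (Γ *ᵥ β t - g)) (β (t + 1))

/-- The upper curvature `μ₂ = (3/2) α λ_max + (1 - α)`. -/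
def mu2 (α lmax : ℝ) : ℝ := α * (3 * lmax / 2) + (1 - α)

end REN

end

/-! Randomness enters only through one event, on which the trimmed Gram matrix T satisfies |vᵀTv −
vᵀΣv| ≤ (λ_min/1000)‖v‖₂² + (λ_min/(1000k))‖v‖₁² for every v (`exists_event_trimmedGram`). The rest
is deterministic.

Optimization. This closeness gives `GammaHat` lower and upper curvature up to an error τ‖v‖₁²
(`restricted_curvature`). One projected step, tested against the minimizer β̂, contracts the squared
distance to β̂ up to ℓ₁ errors (`projGrad_step`); the linear term is seen only through the
optimality of β̂. Since the radius is exactly ‖β*‖₁, feasible points differ from β* by vectors with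
‖·‖₁ ≤ 2√k‖·‖₂. The ℓ₁ errors thus become kτ times squared ℓ₂ distances; as kτ is a small fraction
of the curvature, they are absorbed into the contraction and a multiple of ‖β̂ − β*‖₂²
(`projGrad_convergence`).

Probability. Along a fixed direction the clean Gram form is a sum of independent squares of
sub-Gaussian variables, controlled by Bernstein's inequality. A union bound covers the (2p)^(k+1)
lists of k+1 signed basis vectors, and Maurey's empirical method passes to all v at the price of
‖v‖₁²/k (`dotProduct_mulVec_le_of_signedSum`). If clean entries are at most r, trimming keeps no
product larger than r², so corruption moves each Gram entry by at most 3n_o r²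
(`abs_trimmedInner_sub_sum_le`). With r² of order σ_x² log p / n, the outlier condition makes this
O(λ_min/k). -/

namespace REN

/-! ### Norms and the cone of feasible directions -/

section Norms

variable {p : ℕ}

lemma l1Norm_eq_sum (v : Fin p → ℝ) : l1Norm v = ∑ i, |v i| := by
  simp [l1Norm, PiLp.norm_eq_of_L1]

lemma l2Norm_sq (v : Fin p → ℝ) : l2Norm v ^ 2 = v ⬝ᵥ v := by
  rw [l2Norm, EuclideanSpace.real_norm_sq_eq]; simp [dotProduct, pow_two]

lemma l2Norm_nonneg (v : Fin p → ℝ) : 0 ≤ l2Norm v := norm_nonneg _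

lemma l1Norm_nonneg (v : Fin p → ℝ) : 0 ≤ l1Norm v := norm_nonneg _

lemma l1Norm_add_le (v w : Fin p → ℝ) : l1Norm (v + w) ≤ l1Norm v + l1Norm w := by
  simpa [l1Norm] using norm_add_le (WithLp.toLp 1 v : PiLp 1 fun _ : Fin p => ℝ) (WithLp.toLp 1 w)

lemma l2Norm_add_le (v w : Fin p → ℝ) : l2Norm (v + w) ≤ l2Norm v + l2Norm w := by
  simpa [l2Norm] using norm_add_le (WithLp.toLp 2 v : EuclideanSpace ℝ (Fin p)) (WithLp.toLp 2 w)

lemma l1Norm_sub_comm (v w : Fin p → ℝ) : l1Norm (v - w) = l1Norm (w - v) := by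
  simp [l1Norm_eq_sum, abs_sub_comm]

lemma l1Norm_smul (c : ℝ) (v : Fin p → ℝ) : l1Norm (c • v) = |c| * l1Norm v := by
  simp [l1Norm_eq_sum, abs_mul, Finset.mul_sum]

lemma l2Norm_smul (c : ℝ) (v : Fin p → ℝ) : l2Norm (c • v) = |c| * l2Norm v := by
  simp [l2Norm, norm_smul]

/-- The `ℓ₁` ball is convex. -/
lemma add_smul_sub_mem_l1Ball {R s : ℝ} {a b : Fin p → ℝ} (ha : a ∈ l1Ball p R)
    (hb : b ∈ l1Ball p R) (hs : 0 ≤ s) (hs1 : s ≤ 1) : a + s • (b - a) ∈ l1Ball p R := by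
  have e : a + s • (b - a) = (1 - s) • a + s • b := by
    ext i; simp; ring
  simp only [l1Ball, Set.mem_ofPred_eq] at *
  rw [e]
  refine (l1Norm_add_le _ _).trans ?_
  rw [l1Norm_smul, l1Norm_smul, abs_of_nonneg hs, abs_of_nonneg (sub_nonneg.2 hs1)]
  nlinarith

/-- Restriction of a vector to a `k`-sparse support costs a factor `√k` between the norms. -/
lemma sum_abs_le_sqrt_mul_l2Norm (T : Finset (Fin p)) {k : ℕ} (hT : T.card ≤ k)
    (v : Fin p → ℝ) : ∑ i ∈ T, |v i| ≤ √k * l2Norm v := by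
  have h1 : (∑ i ∈ T, |v i|) ^ 2 ≤ k * l2Norm v ^ 2 := by
    calc (∑ i ∈ T, |v i|) ^ 2 ≤ T.card * ∑ i ∈ T, |v i| ^ 2 := sq_sum_le_card_mul_sum_sq
      _ ≤ k * ∑ i, |v i| ^ 2 := by
          gcongr
          exact Finset.subset_univ _
      _ = k * l2Norm v ^ 2 := by
          rw [l2Norm_sq]; simp [dotProduct, pow_two]
  calc ∑ i ∈ T, |v i| ≤ √(k * l2Norm v ^ 2) := Real.le_sqrt_of_sq_le h1
    _ = √k * l2Norm v := by
      rw [Real.sqrt_mul (Nat.cast_nonneg k), Real.sqrt_sq (l2Norm_nonneg v)]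

/-- Feasible points differ from a sparse boundary point of the `ℓ₁` ball by a vector in a cone. -/
lemma l1Norm_sub_le_of_sparse {k : ℕ} {b x : Fin p → ℝ} (hb : {j | b j ≠ 0}.ncard ≤ k)
    (hx : l1Norm x ≤ l1Norm b) : l1Norm (x - b) ≤ 2 * √k * l2Norm (x - b) := by
  classical
  set T : Finset (Fin p) := Finset.univ.filter fun j => b j ≠ 0 with hT
  have hc : T.card ≤ k := by
    rw [← Set.ncard_coe_finset]
    simpa [hT] using hb
  have h0 : ∀ j ∈ Tᶜ, b j = 0 := by simp [hT]
  have h1 := sum_abs_le_sqrt_mul_l2Norm T hc (x - b)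
  rw [l1Norm_eq_sum, l1Norm_eq_sum, ← Finset.sum_add_sum_compl T,
    ← Finset.sum_add_sum_compl T (fun i => |b i|)] at hx
  rw [l1Norm_eq_sum, ← Finset.sum_add_sum_compl T]
  have h2 : ∑ i ∈ Tᶜ, |(x - b) i| = ∑ i ∈ Tᶜ, |x i| :=
    Finset.sum_congr rfl fun i hi => by simp [h0 i hi]
  have h3 : ∑ i ∈ Tᶜ, |b i| = 0 := Finset.sum_eq_zero fun i hi => by simp [h0 i hi]
  -- With `hx`, this bounds the mass of `x` off the support by the mass of `x - b` on it.
  have h4 : ∑ i ∈ T, |b i| ≤ ∑ i ∈ T, |(x - b) i| + ∑ i ∈ T, |x i| := by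
    rw [← Finset.sum_add_distrib]
    refine Finset.sum_le_sum fun i _ => ?_
    have := abs_sub_abs_le_abs_sub (b i) (x i)
    rw [abs_sub_comm] at this
    simp only [Pi.sub_apply]; linarith
  linarith

end Norms

/-! ### Projected gradient descent under restricted curvature -/

section Optimization

variable {p : ℕ} {Γ : Matrix (Fin p) (Fin p) ℝ} {g : Fin p → ℝ} {R : ℝ}

/-- Dividing by s and letting s → 0 leaves the linear coefficient. This turns minimality along a
segment into a first-order condition. -/
lemma nonneg_of_forall_add_sq {a b : ℝ} (h : ∀ s : ℝ, 0 < s → s ≤ 1 → 0 ≤ s * a + s ^ 2 * b) :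
    0 ≤ a := by
  by_contra! ha
  have hb : 0 < |b| + 1 := by positivity
  set s := min 1 (-a / (2 * (|b| + 1))) with hs
  have hs0 : 0 < s := lt_min one_pos (by apply div_pos <;> linarith)
  have h1 := h s hs0 (min_le_left _ _)
  have h2 : s * (2 * (|b| + 1)) ≤ -a := by
    rw [← le_div_iff₀ (by positivity)]; exact min_le_right _ _
  have h3 : 0 ≤ a + s * b := by
    by_contra! hc
    nlinarith
  nlinarith [le_abs_self b]

lemma dotProduct_mulVec_comm (hΓ : Γ.IsSymm) (v w : Fin p → ℝ) :
    v ⬝ᵥ (Γ *ᵥ w) = w ⬝ᵥ (Γ *ᵥ v) := by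
  rw [Matrix.dotProduct_mulVec, ← Matrix.mulVec_transpose, hΓ.eq, dotProduct_comm]

/-- First-order optimality over the `ℓ₁` ball. -/
lemma IsSolution.variational (hΓ : Γ.IsSymm) {b w : Fin p → ℝ} (hb : IsSolution Γ g R b)
    (hw : w ∈ l1Ball p R) : 0 ≤ (Γ *ᵥ b - g) ⬝ᵥ (w - b) := by
  refine nonneg_of_forall_add_sq (b := (1 / 2) * ((w - b) ⬝ᵥ (Γ *ᵥ (w - b)))) fun s hs hs1 => ?_
  have h := hb.2 (add_smul_sub_mem_l1Ball hb.1 hw hs.le hs1)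
  simp only [Set.mem_ofPred_eq, loss] at h
  set D := w - b
  have hc := dotProduct_mulVec_comm hΓ b D
  simp only [Matrix.mulVec_add, Matrix.mulVec_smul, dotProduct_add, add_dotProduct,
    smul_dotProduct, dotProduct_smul, smul_eq_mul] at h
  rw [sub_dotProduct, dotProduct_comm (Γ *ᵥ b) D]
  rw [hc] at h
  nlinarith

/-- The obtuse angle property of the Euclidean projection. -/
lemma IsL1Projection.variational {v z w : Fin p → ℝ} (hz : IsL1Projection R v z)
    (hw : w ∈ l1Ball p R) : (v - z) ⬝ᵥ (w - z) ≤ 0 := by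
  rw [← neg_nonneg]
  have key : 0 ≤ 2 * -((v - z) ⬝ᵥ (w - z)) := by
    refine nonneg_of_forall_add_sq (b := (w - z) ⬝ᵥ (w - z)) fun s hs hs1 => ?_
    have h := hz.2 (add_smul_sub_mem_l1Ball hz.1 hw hs.le hs1)
    simp only [Set.mem_ofPred_eq] at h
    have h2 := pow_le_pow_left₀ (l2Norm_nonneg _) h 2
    rw [l2Norm_sq, l2Norm_sq, ← sub_sub] at h2
    generalize v - z = F at h2 ⊢
    generalize w - z = D at h2 ⊢
    simp only [sub_dotProduct, dotProduct_sub, smul_dotProduct, dotProduct_smul, smul_eq_mul,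
      dotProduct_comm D F] at h2
    nlinarith
  linarith

/-- One step of projected gradient descent under restricted strong convexity and smoothness. -/
lemma projGrad_step {η μ τ : ℝ} (hη : 0 < η) (hτ : 0 ≤ τ) (hΓ : Γ.IsSymm)
    (hlow : ∀ v, μ * l2Norm v ^ 2 - τ * l1Norm v ^ 2 ≤ v ⬝ᵥ (Γ *ᵥ v))
    (hup : ∀ v, v ⬝ᵥ (Γ *ᵥ v) ≤ η * l2Norm v ^ 2 + τ * l1Norm v ^ 2)
    {b x z : Fin p → ℝ} (hb : IsSolution Γ g R b)
    (hz : IsL1Projection R (x - (1 / η) • (Γ *ᵥ x - g)) z) :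
    (η + μ) * l2Norm (z - b) ^ 2 ≤ (η - μ) * l2Norm (x - b) ^ 2
      + 3 * τ * (l1Norm (x - b) ^ 2 + l1Norm (z - b) ^ 2) := by
  have h1 := hb.variational hΓ hz.1
  have h2 := hz.variational hb.1
  have h3 := hlow (x - b)
  have h4 := hlow (z - b)
  have h5 := hup (x - z)
  have h6 : l1Norm (x - z) ^ 2 ≤ 2 * l1Norm (x - b) ^ 2 + 2 * l1Norm (z - b) ^ 2 := by
    have e : x - z = (x - b) + (b - z) := by abel
    have := l1Norm_add_le (x - b) (b - z)
    rw [← e, l1Norm_sub_comm b z] at this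
    nlinarith [l1Norm_nonneg (x - z), l1Norm_nonneg (x - b), l1Norm_nonneg (z - b),
      sq_nonneg (l1Norm (x - b) - l1Norm (z - b))]
  obtain ⟨D, rfl⟩ : ∃ D, x = b + D := ⟨x - b, by abel⟩
  obtain ⟨F, rfl⟩ : ∃ F, z = b + F := ⟨z - b, by abel⟩
  have e1 : b + D - b = D := by abel
  have e2 : b + F - b = F := by abel
  have e3 : b + D - (b + F) = D - F := by abel
  have e4 : b - (b + F) = -F := by abel
  have e5 : b + D - (1 / η) • (Γ *ᵥ (b + D) - g) - (b + F)
      = D - F - (1 / η) • (Γ *ᵥ b - g + Γ *ᵥ D) := by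
    rw [Matrix.mulVec_add]; ext i; simp; ring
  rw [e5, e4] at h2
  simp only [e1, e2, e3, l2Norm_sq] at *
  rw [dotProduct_neg, sub_dotProduct, smul_dotProduct, smul_eq_mul, add_dotProduct] at h2
  have hη' : η * (1 / η) = 1 := by field_simp
  have h7 : (Γ *ᵥ b - g) ⬝ᵥ F + (Γ *ᵥ D) ⬝ᵥ F ≤ η * ((D - F) ⬝ᵥ F) := by
    have := mul_le_mul_of_nonneg_left h2 hη.le
    have e : η * -((D - F) ⬝ᵥ F - 1 / η * ((Γ *ᵥ b - g) ⬝ᵥ F + (Γ *ᵥ D) ⬝ᵥ F))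
      = -(η * ((D - F) ⬝ᵥ F)) + (η * (1 / η)) * ((Γ *ᵥ b - g) ⬝ᵥ F + (Γ *ᵥ D) ⬝ᵥ F) := by ring
    rw [e, hη'] at this
    linarith
  -- The gradient term at the minimizer is nonnegative by `h1` and is dropped; `g` disappears here.
  have h8 : (Γ *ᵥ D) ⬝ᵥ F ≤ η * ((D - F) ⬝ᵥ F) := by linarith
  rw [dotProduct_comm] at h8
  have hs := dotProduct_mulVec_comm hΓ D F
  simp only [Matrix.mulVec_sub, dotProduct_sub, sub_dotProduct] at h5 h8
  rw [hs] at h5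
  rw [dotProduct_comm F D] at h5
  -- Polarization writes 2 DᵀΓF as DᵀΓD + FᵀΓF − (D−F)ᵀΓ(D−F). The upper curvature at D − F
  -- contributes η‖D−F‖², whose cross term cancels that of `h8`. Of the 3τ, one comes from the lower
  -- bounds and two from `h6`.
  nlinarith [mul_le_mul_of_nonneg_left h6 hτ]

/-- Convergence of projected gradient descent to within the distance between `βhat` and a sparse
point of the boundary of the `ℓ₁` ball. -/
lemma projGrad_convergence {η μ τ : ℝ} {k : ℕ} (hμ : 0 < μ) (hμη : μ ≤ η) (hτ : 0 ≤ τ)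
    (hτk : 480 * (k * τ) ≤ μ) (hΓ : Γ.IsSymm)
    (hlow : ∀ v, μ * l2Norm v ^ 2 - τ * l1Norm v ^ 2 ≤ v ⬝ᵥ (Γ *ᵥ v))
    (hup : ∀ v, v ⬝ᵥ (Γ *ᵥ v) ≤ η * l2Norm v ^ 2 + τ * l1Norm v ^ 2)
    {βstar βhat : Fin p → ℝ} {β : ℕ → Fin p → ℝ} (hs : {j | βstar j ≠ 0}.ncard ≤ k)
    (hb : IsSolution Γ g (l1Norm βstar) βhat)
    (hβ : IsProjGradDescent Γ g (l1Norm βstar) η β) (t : ℕ) :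
    l2Norm (β t - βhat) ^ 2
        ≤ ((η - 19 / 20 * μ) / (η + 19 / 20 * μ)) ^ t * l2Norm (β 0 - βhat) ^ 2
          + l2Norm (βhat - βstar) ^ 2 ∧
      l1Norm (β t - βhat) ≤ 2 * √k * l2Norm (β t - βhat) + 2 * √k * l2Norm (βhat - βstar)
        + l1Norm (βhat - βstar) := by
  have hfeas : ∀ t, β t ∈ l1Ball p (l1Norm βstar) := by
    intro t
    cases t with
    | zero => exact hβ.1
    | succ t => exact (hβ.2 t).1
  have hη : 0 < η := hμ.trans_le hμη
  have hk0 : (0 : ℝ) ≤ √k := Real.sqrt_nonneg _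
  have hk2 : √k ^ 2 = k := Real.sq_sqrt (Nat.cast_nonneg k)
  have hcone : ∀ t, l1Norm (β t - βhat) ≤ 2 * √k * l2Norm (β t - βhat)
      + 2 * √k * l2Norm (βhat - βstar) + l1Norm (βhat - βstar) := by
    intro t
    have h1 : l1Norm (β t - βstar) ≤ 2 * √k * l2Norm (β t - βstar) :=
      l1Norm_sub_le_of_sparse hs (hfeas t)
    have h2 := l1Norm_add_le (β t - βstar) (βstar - βhat)
    have h3 := l2Norm_add_le (β t - βhat) (βhat - βstar)
    rw [sub_add_sub_cancel] at h2 h3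
    rw [l1Norm_sub_comm βstar βhat] at h2
    nlinarith
  refine ⟨?_, hcone t⟩
  set δ := l2Norm (βhat - βstar)
  have hδ0 : 0 ≤ δ := l2Norm_nonneg _
  have hδ1 : l1Norm (βhat - βstar) ≤ 2 * √k * δ := l1Norm_sub_le_of_sparse hs hb.1
  have hsq : ∀ t, τ * l1Norm (β t - βhat) ^ 2
      ≤ k * τ * (8 * l2Norm (β t - βhat) ^ 2 + 32 * δ ^ 2) := by
    intro t
    have h1 : l1Norm (β t - βhat) ≤ √k * (2 * l2Norm (β t - βhat) + 4 * δ) := by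
      linarith [hcone t]
    have h2 := pow_le_pow_left₀ (l1Norm_nonneg _) h1 2
    rw [mul_pow, hk2] at h2
    have h3 : (2 * l2Norm (β t - βhat) + 4 * δ) ^ 2
        ≤ 8 * l2Norm (β t - βhat) ^ 2 + 32 * δ ^ 2 := by
      nlinarith [sq_nonneg (2 * l2Norm (β t - βhat) - 4 * δ)]
    have hk : (0 : ℝ) ≤ k := Nat.cast_nonneg k
    calc τ * l1Norm (β t - βhat) ^ 2
        ≤ τ * (k * (8 * l2Norm (β t - βhat) ^ 2 + 32 * δ ^ 2)) := by
          refine mul_le_mul_of_nonneg_left (h2.trans ?_) hτ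
          exact mul_le_mul_of_nonneg_left h3 hk
      _ = _ := by ring
  have hstep : ∀ t, l2Norm (β (t + 1) - βhat) ^ 2
      ≤ (η - 19 / 20 * μ) / (η + 19 / 20 * μ) * l2Norm (β t - βhat) ^ 2
        + (2 / 5 * μ) / (η + 19 / 20 * μ) * δ ^ 2 := by
    intro t
    have h1 := projGrad_step hη hτ hΓ hlow hup hb (hβ.2 t)
    have h2 := hsq t
    have h3 := hsq (t + 1)
    have hden : 0 < η + 19 / 20 * μ := by linarith
    have e : (η - 19 / 20 * μ) / (η + 19 / 20 * μ) * l2Norm (β t - βhat) ^ 2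
        + (2 / 5 * μ) / (η + 19 / 20 * μ) * δ ^ 2
        = ((η - 19 / 20 * μ) * l2Norm (β t - βhat) ^ 2 + 2 / 5 * μ * δ ^ 2)
          / (η + 19 / 20 * μ) := by ring
    rw [e, le_div_iff₀ hden]
    -- By `hsq`, the ℓ₁ errors cost 3·8/480 = 1/20 of μ on each side, and 3·64/480 = 2/5 of μ in
    -- front of δ².
    have ha := mul_le_mul_of_nonneg_right hτk (sq_nonneg (l2Norm (β t - βhat)))
    have hb := mul_le_mul_of_nonneg_right hτk (sq_nonneg (l2Norm (β (t + 1) - βhat)))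
    have hc := mul_le_mul_of_nonneg_right hτk (sq_nonneg δ)
    linarith
  have hden : 0 < η + 19 / 20 * μ := by linarith
  have hγ0 : 0 ≤ (η - 19 / 20 * μ) / (η + 19 / 20 * μ) := div_nonneg (by linarith) hden.le
  induction t with
  | zero => simp; positivity
  | succ t ih =>
    refine (hstep t).trans ?_
    have h1 := mul_le_mul_of_nonneg_left ih hγ0
    -- The additive error does not accumulate: the contraction factor and the coefficient of δ² sum
    -- to at most 1.
    have h2 : (η - 19 / 20 * μ) / (η + 19 / 20 * μ) + (2 / 5 * μ) / (η + 19 / 20 * μ) ≤ 1 := by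
      rw [← add_div, div_le_one hden]; linarith
    have h3 := mul_le_mul_of_nonneg_right h2 (sq_nonneg δ)
    rw [pow_succ ((η - 19 / 20 * μ) / (η + 19 / 20 * μ))]
    linarith

end Optimization

/-! ### Robustness of the trimmed inner product -/

section Trimmed

variable {m h : ℕ}

/-- If at most `h` of the products differ from reference values bounded by `B`, then the trimmed
inner product is within `3 * h * B` of the sum of the reference values. -/
lemma abs_trimmedInner_sub_sum_le {u v q : Fin m → ℝ} {B : ℝ} (hB : 0 ≤ B)
    (hq : ∀ i, |q i| ≤ B) (hbad : (Finset.univ.filter fun i => u i * v i ≠ q i).card ≤ h) :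
    |trimmedInner h u v - ∑ i, q i| ≤ 3 * (h * B) := by
  classical
  set f : Fin m → ℝ := fun i => |u i * v i| with hf
  set σ := Tuple.sort f with hσ
  have hmono : Monotone (f ∘ σ) := Tuple.monotone_sort f
  set L : Finset (Fin m) := Finset.univ.filter fun l : Fin m => (l : ℕ) + h < m with hL
  set K : Finset (Fin m) := L.map σ.toEmbedding with hK
  set Bad := Finset.univ.filter fun i => u i * v i ≠ q i with hBad
  have hT : trimmedInner h u v = ∑ i ∈ K, u i * v i := by
    rw [hK, Finset.sum_map]; rfl
  have hLc : (Lᶜ).card ≤ h := by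
    have : (Lᶜ).map Fin.valEmbedding ⊆ Finset.Ico (m - h) m := by
      intro x hx
      simp only [Finset.mem_map, Finset.mem_compl, hL, Finset.mem_filter, Finset.mem_univ,
        true_and, Fin.valEmbedding_apply, Finset.mem_Ico] at hx ⊢
      obtain ⟨l, hl, rfl⟩ := hx
      have := l.2
      omega
    have h2 := Finset.card_le_card this
    rw [Finset.card_map, Nat.card_Ico] at h2
    omega
  have hKc : (Kᶜ).card ≤ h := by
    rw [Finset.card_compl, hK, Finset.card_map, ← Finset.card_compl]; exact hLc
  -- A kept product has more than `h` products at least as large, counting itself. If it exceeded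
  -- `B`, all of these would be corrupted, which is too many.
  have hkept : ∀ i ∈ K, |u i * v i| ≤ B := by
    intro i hi
    by_contra! hlt
    obtain ⟨l, hl, rfl⟩ := Finset.mem_map.1 hi
    have hl' : (l : ℕ) + h < m := by simpa [hL] using hl
    have hsub : (Finset.Ici l).map σ.toEmbedding ⊆ Bad := by
      intro x hx
      obtain ⟨j, hj, rfl⟩ := Finset.mem_map.1 hx
      have h1 : f (σ l) ≤ f (σ j) := hmono (Finset.mem_Ici.1 hj)
      simp only [hBad, Finset.mem_filter, Finset.mem_univ, true_and]
      intro he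
      have h2 := hq (σ j)
      have h3 : f (σ j) = |q (σ j)| := by simp only [hf]; exact congrArg _ he
      have h4 : B < f (σ l) := hlt
      linarith
    have h2 := Finset.card_le_card hsub
    rw [Finset.card_map, Fin.card_Ici] at h2
    omega
  -- Two error sources: at most `h` corrupted kept terms, each off by 2B, and at most `h` discarded
  -- reference values, each of size at most B.
  have hdiff : trimmedInner h u v - ∑ i, q i
      = ∑ i ∈ K with i ∈ Bad, (u i * v i - q i) - ∑ i ∈ Kᶜ, q i := by
    rw [hT, ← Finset.sum_add_sum_compl K q, Finset.sum_filter_of_ne, Finset.sum_sub_distrib]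
    · ring
    · intro x _ hx
      simp only [hBad, Finset.mem_filter, Finset.mem_univ, true_and]
      intro he; exact hx (by rw [he, sub_self])
  have h1 : |∑ i ∈ K with i ∈ Bad, (u i * v i - q i)| ≤ h * (2 * B) := by
    calc |∑ i ∈ K with i ∈ Bad, (u i * v i - q i)|
        ≤ ∑ i ∈ K with i ∈ Bad, |u i * v i - q i| := Finset.abs_sum_le_sum_abs _ _
      _ ≤ (K.filter (· ∈ Bad)).card • (2 * B) := by
          refine Finset.sum_le_card_nsmul _ _ _ fun i hi => ?_
          have := hkept i (Finset.mem_filter.1 hi).1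
          have := abs_sub (u i * v i) (q i)
          linarith [hq i]
      _ ≤ h * (2 * B) := by
          rw [nsmul_eq_mul]
          gcongr
          refine (Finset.card_le_card ?_).trans hbad
          intro i hi; exact (Finset.mem_filter.1 hi).2
  have h2 : |∑ i ∈ Kᶜ, q i| ≤ h * B := by
    calc |∑ i ∈ Kᶜ, q i| ≤ ∑ i ∈ Kᶜ, |q i| := Finset.abs_sum_le_sum_abs _ _
      _ ≤ (Kᶜ).card • B := Finset.sum_le_card_nsmul _ _ _ fun i _ => hq i
      _ ≤ h * B := by rw [nsmul_eq_mul]; gcongr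
  rw [hdiff]
  have := abs_sub (∑ i ∈ K with i ∈ Bad, (u i * v i - q i)) (∑ i ∈ Kᶜ, q i)
  linarith

lemma trimmedInner_comm (u v : Fin m → ℝ) : trimmedInner h u v = trimmedInner h v u := by
  have : (fun i => |u i * v i|) = fun i => |v i * u i| := by ext i; rw [mul_comm]
  simp only [trimmedInner, this]
  exact Finset.sum_congr rfl fun _ _ => mul_comm _ _

lemma isSymm_GammaHat {p : ℕ} (α : ℝ) (X : Matrix (Fin m) (Fin p) ℝ) :
    (GammaHat α h X).IsSymm := by
  ext a b
  simp only [GammaHat, Matrix.transpose_apply, Matrix.of_apply]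
  rw [trimmedInner_comm, Matrix.one_apply, Matrix.one_apply]
  simp [eq_comm]

end Trimmed

/-! ### Quadratic forms, Maurey's method and Rayleigh quotients -/

section QuadraticForms

/-- An entrywise bound controls the quadratic form through the `ℓ₁` norm. -/
lemma abs_dotProduct_mulVec_le {p : ℕ} {M : Matrix (Fin p) (Fin p) ℝ} {B : ℝ}
    (hM : ∀ a b, |M a b| ≤ B) (v : Fin p → ℝ) : |v ⬝ᵥ (M *ᵥ v)| ≤ B * l1Norm v ^ 2 := by
  calc |v ⬝ᵥ (M *ᵥ v)| = |∑ a, ∑ b, v a * (M a b * v b)| := by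
        simp only [dotProduct, Matrix.mulVec, Finset.mul_sum]
    _ ≤ ∑ a, ∑ b, |v a * (M a b * v b)| :=
        (Finset.abs_sum_le_sum_abs _ _).trans
          (Finset.sum_le_sum fun _ _ => Finset.abs_sum_le_sum_abs _ _)
    _ ≤ ∑ a, ∑ b, B * (|v a| * |v b|) := by
        refine Finset.sum_le_sum fun a _ => Finset.sum_le_sum fun b _ => ?_
        rw [abs_mul, abs_mul]
        nlinarith [hM a b, mul_nonneg (abs_nonneg (v a)) (abs_nonneg (v b))]
    _ = B * l1Norm v ^ 2 := by
        simp only [← Finset.mul_sum, l1Norm_eq_sum, pow_two, Finset.sum_mul]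

variable {E ι : Type*} [AddCommGroup E] [Module ℝ E] [Fintype ι]

/-- Some sum of `m` atoms attains at least the mean, over independent draws with weights `w`, of a
quadratic form translated by `u`. -/
lemma exists_sum_atoms_ge (B : E →ₗ[ℝ] E →ₗ[ℝ] ℝ) (w : ι → ℝ) (hw : ∀ i, 0 ≤ w i)
    (hw1 : ∑ i, w i = 1) (y : ι → E) (v : E) (hv : ∑ i, w i • y i = v) (m : ℕ) :
    ∀ u : E, ∃ g : Fin m → ι,
      B u u + m * (B u v + B v u) + m * (m - 1) * B v v + m * ∑ i, w i * B (y i) (y i)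
        ≤ B (u + ∑ j, y (g j)) (u + ∑ j, y (g j)) := by
  induction m with
  | zero => intro u; exact ⟨Fin.elim0, by simp⟩
  | succ m ih =>
    intro u
    set κ := ∑ i, w i * B (y i) (y i) with hκ
    set H : E → ℝ := fun u => B u u + m * (B u v + B v u) + m * (m - 1) * B v v + m * κ with hH
    set T := B u u + (m + 1 : ℕ) * (B u v + B v u) + (m + 1 : ℕ) * ((m + 1 : ℕ) - 1) * B v v
      + (m + 1 : ℕ) * κ with hT
    have hl : ∀ x, ∑ i, w i * B x (y i) = B x v := by
      intro x; rw [← hv]; simp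
    have hr : ∀ x, ∑ i, w i * B (y i) x = B v x := by
      intro x; rw [← hv]; simp
    -- Derandomization one draw at a time: `H` is the inductive lower bound, and its mean over one
    -- more draw is the target, so some atom attains it.
    have hmean : ∑ i, w i * H (u + y i) = T := by
      have e : ∀ i, w i * H (u + y i) = w i * H u + (w i * B u (y i) + w i * B (y i) u)
          + w i * B (y i) (y i) + m * (w i * B (y i) v + w i * B v (y i)) := by
        intro i
        simp only [hH, map_add, LinearMap.add_apply]
        ring
      simp only [e, Finset.sum_add_distrib, ← Finset.mul_sum, hl, hr, ← hκ]
      rw [← Finset.sum_mul, hw1, hT, hH]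
      push_cast
      ring
    obtain ⟨i, hi⟩ : ∃ i, T ≤ H (u + y i) := by
      by_contra! hc
      have hpos : ∃ i, 0 < w i := by
        by_contra! h0
        have : ∑ i, w i ≤ 0 := Finset.sum_nonpos fun i _ => h0 i
        linarith
      obtain ⟨j, hj⟩ := hpos
      have : ∑ i, w i * H (u + y i) < ∑ i, w i * T :=
        Finset.sum_lt_sum (fun i _ => mul_le_mul_of_nonneg_left (hc i).le (hw i))
          ⟨j, Finset.mem_univ _, mul_lt_mul_of_pos_left (hc j) hj⟩
      rw [hmean, ← Finset.sum_mul, hw1, one_mul] at this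
      exact lt_irrefl _ this
    obtain ⟨g, hg⟩ := ih (u + y i)
    refine ⟨Fin.cons i g, hi.trans (hg.trans (le_of_eq ?_))⟩
    simp [Fin.sum_univ_succ, add_assoc]

/-- If a quadratic form is nonpositive at all sums of `m` atoms, it is almost nonpositive at convex
combinations of the atoms. -/
lemma mul_apply_le_of_sum_atoms_nonpos (B : E →ₗ[ℝ] E →ₗ[ℝ] ℝ) (w : ι → ℝ) (hw : ∀ i, 0 ≤ w i)
    (hw1 : ∑ i, w i = 1) (y : ι → E) (v : E) (hv : ∑ i, w i • y i = v) (m : ℕ)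
    (hB : ∀ g : Fin (m + 1) → ι, B (∑ j, y (g j)) (∑ j, y (g j)) ≤ 0) :
    m * B v v + ∑ i, w i * B (y i) (y i) ≤ 0 := by
  -- Among m + 1 draws there are (m + 1)m ordered pairs of distinct ones; dividing by m + 1 leaves
  -- the factor m.
  obtain ⟨g, hg⟩ := exists_sum_atoms_ge B w hw hw1 y v hv (m + 1) 0
  have h := hg.trans (by simpa using hB g)
  simp only [map_zero, LinearMap.zero_apply, add_zero, mul_zero, zero_add] at h
  push_cast at h
  have hm : (0 : ℝ) < m + 1 := by positivity
  have : (m + 1 : ℝ) * (m * B v v + ∑ i, w i * B (y i) (y i)) ≤ 0 := by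
    ring_nf at h ⊢; linarith
  by_contra! hc
  linarith [mul_pos hm hc]

/-- The sum of the signed basis vectors listed by `g`. -/
def signedSum {p m : ℕ} (g : Fin m → Fin p × Bool) : Fin p → ℝ :=
  ∑ j, Pi.single (g j).1 (if (g j).2 then (1 : ℝ) else -1)

/-- A bound on a quadratic form at the sums of `k + 1` signed basis vectors extends to all vectors,
with an additional `ℓ₁` term. -/
lemma dotProduct_mulVec_le_of_signedSum {p k : ℕ} (hk : 0 < k) {M : Matrix (Fin p) (Fin p) ℝ}
    {δ : ℝ} (hM : ∀ g : Fin (k + 1) → Fin p × Bool,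
      |signedSum g ⬝ᵥ (M *ᵥ signedSum g)| ≤ δ * l2Norm (signedSum g) ^ 2) (v : Fin p → ℝ) :
    v ⬝ᵥ (M *ᵥ v) ≤ δ * (l2Norm v ^ 2 + 2 * l1Norm v ^ 2 / k) := by
  classical
  set r := l1Norm v with hr
  rcases (l1Norm_nonneg v).eq_or_lt with h0 | h0
  · have hv : v = 0 := by
      rw [l1Norm_eq_sum, eq_comm, Finset.sum_eq_zero_iff_of_nonneg (fun _ _ => abs_nonneg _)] at h0
      ext i; simpa using h0 i
    subst hv
    simp [l2Norm_sq, hr, ← h0]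
  let bl : (Fin p → ℝ) →ₗ[ℝ] (Fin p → ℝ) →ₗ[ℝ] ℝ :=
    Matrix.toLinearMap₂' ℝ (M - δ • (1 : Matrix (Fin p) (Fin p) ℝ))
  have hbl : ∀ x, bl x x = x ⬝ᵥ (M *ᵥ x) - δ * (x ⬝ᵥ x) := by
    intro x
    simp [bl, Matrix.toLinearMap₂'_apply']
  set sg : Fin p → Bool := fun i => decide (0 ≤ v i) with hsg
  set e : Fin p → Fin p → ℝ := fun i => Pi.single i (if sg i then (1 : ℝ) else -1) with he
  have hsum : ∀ (m : ℕ) (g : Fin m → Fin p),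
      ∑ j, r • e (g j) = r • signedSum fun j => (g j, sg (g j)) := by
    intro m g; rw [← Finset.smul_sum]; rfl
  -- The constant list gives a multiple of a single signed basis vector, so the hypothesis also
  -- controls the diagonal terms in Maurey's bound.
  have hone : ∀ i, bl (e i) (e i) ≥ -2 * δ ∧ 0 ≤ δ := by
    intro i
    have h1 := hM fun _ => (i, sg i)
    have h2 : (signedSum fun _ : Fin (k + 1) => (i, sg i)) = (k + 1 : ℝ) • e i := by
      ext a
      simp [signedSum, he]
    rw [h2, Matrix.mulVec_smul, smul_dotProduct, dotProduct_smul, smul_eq_mul, smul_eq_mul,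
      l2Norm_smul, mul_pow, sq_abs, l2Norm_sq, ← mul_assoc, abs_mul,
      abs_of_nonneg (by positivity)] at h1
    have h3 : e i ⬝ᵥ e i = 1 := by
      simp only [he]; split_ifs <;> simp
    have hp : (0 : ℝ) < (k + 1) * (k + 1) := by positivity
    have h4 : |e i ⬝ᵥ (M *ᵥ e i)| ≤ δ := by
      rw [h3] at h1
      by_contra! hc
      nlinarith
    rw [hbl, h3]
    exact ⟨by linarith [neg_abs_le (e i ⬝ᵥ (M *ᵥ e i))], (abs_nonneg _).trans h4⟩
  -- `v` is the convex combination, with weights |v i|/r, of the vertices r · sign(v i) eᵢ of its ℓ₁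
  -- ball.
  have key := mul_apply_le_of_sum_atoms_nonpos bl (fun i => |v i| / r)
    (fun i => div_nonneg (abs_nonneg _) h0.le)
    (by rw [← Finset.sum_div, ← l1Norm_eq_sum, div_self h0.ne'])
    (fun i => r • e i) v ?_ k ?_
  · have h1 : -(2 * δ * r ^ 2) ≤ ∑ i, |v i| / r * bl (r • e i) (r • e i) := by
      calc -(2 * δ * r ^ 2) = ∑ i, |v i| / r * (r ^ 2 * (-2 * δ)) := by
            rw [← Finset.sum_mul, ← Finset.sum_div, ← l1Norm_eq_sum, div_self h0.ne']; ring
        _ ≤ _ := by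
            refine Finset.sum_le_sum fun i _ => ?_
            refine mul_le_mul_of_nonneg_left ?_ (div_nonneg (abs_nonneg _) h0.le)
            rw [map_smul, map_smul, LinearMap.smul_apply, smul_eq_mul, smul_eq_mul,
              ← mul_assoc r r, ← pow_two]
            exact mul_le_mul_of_nonneg_left (hone i).1 (sq_nonneg _)
    rw [hbl, ← l2Norm_sq] at key
    have hk' : (0 : ℝ) < k := by exact_mod_cast hk
    have h2 : v ⬝ᵥ (M *ᵥ v) - δ * l2Norm v ^ 2 ≤ 2 * δ * r ^ 2 / k := by
      rw [le_div_iff₀ hk']; linarith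
    calc v ⬝ᵥ (M *ᵥ v) ≤ δ * l2Norm v ^ 2 + 2 * δ * r ^ 2 / k := by linarith
      _ = _ := by ring
  · ext a
    simp only [Finset.sum_apply, Pi.smul_apply, smul_eq_mul, he, Pi.single_apply]
    rw [Finset.sum_eq_single a]
    · have : r ≠ 0 := h0.ne'
      by_cases hva : 0 ≤ v a
      · simp [hsg, hva, abs_of_nonneg hva]; field_simp
      · simp [hsg, hva, abs_of_neg (not_le.1 hva)]; field_simp
    · intro b _ hb; simp [hb.symm]
    · simp
  · intro g
    rw [hsum, map_smul, map_smul, LinearMap.smul_apply, smul_eq_mul, smul_eq_mul, hbl]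
    have h1 := (le_abs_self _).trans (hM fun j => (g j, sg (g j)))
    rw [l2Norm_sq] at h1
    rw [← mul_assoc]
    exact mul_nonpos_of_nonneg_of_nonpos (mul_self_nonneg r) (by linarith)

lemma abs_dotProduct_mulVec_le_of_signedSum {p k : ℕ} (hk : 0 < k)
    {M : Matrix (Fin p) (Fin p) ℝ} {δ : ℝ} (hM : ∀ g : Fin (k + 1) → Fin p × Bool,
      |signedSum g ⬝ᵥ (M *ᵥ signedSum g)| ≤ δ * l2Norm (signedSum g) ^ 2) (v : Fin p → ℝ) :
    |v ⬝ᵥ (M *ᵥ v)| ≤ δ * (l2Norm v ^ 2 + 2 * l1Norm v ^ 2 / k) := by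
  refine abs_le'.2 ⟨dotProduct_mulVec_le_of_signedSum hk hM v, ?_⟩
  have := dotProduct_mulVec_le_of_signedSum hk (M := -M) (δ := δ)
    (fun g => by simpa [Matrix.neg_mulVec] using hM g) v
  simpa [Matrix.neg_mulVec] using this

/-- The Rayleigh quotient of a symmetric matrix is bounded by its extreme eigenvalues. -/
lemma rayleigh_bounds {p : ℕ} {S : Matrix (Fin p) (Fin p) ℝ} (hS : S.IsSymm) {a b : ℝ}
    (ha : IsLeast (spectrum ℝ S) a) (hb : IsGreatest (spectrum ℝ S) b) (v : Fin p → ℝ) :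
    a * l2Norm v ^ 2 ≤ v ⬝ᵥ (S *ᵥ v) ∧ v ⬝ᵥ (S *ᵥ v) ≤ b * l2Norm v ^ 2 := by
  have hH : S.IsHermitian := by
    rw [Matrix.IsHermitian, Matrix.conjTranspose_eq_transpose_of_trivial]; exact hS
  have hA : ∀ c : ℝ, (algebraMap ℝ (Matrix (Fin p) (Fin p) ℝ) c).IsHermitian := by
    intro c
    rw [Algebra.algebraMap_eq_smul_one]
    simp [Matrix.IsHermitian]
  have h1 : (S - algebraMap ℝ _ a).PosSemidef := by
    refine Matrix.posSemidef_iff_isHermitian_and_spectrum_nonneg.2 ⟨hH.sub (hA a), ?_⟩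
    rw [← spectrum.sub_singleton_eq]
    rintro _ ⟨x, hx, y, rfl, rfl⟩
    exact sub_nonneg.2 (ha.2 hx)
  have h2 : (algebraMap ℝ _ b - S).PosSemidef := by
    refine Matrix.posSemidef_iff_isHermitian_and_spectrum_nonneg.2 ⟨(hA b).sub hH, ?_⟩
    rw [← spectrum.singleton_sub_eq]
    rintro _ ⟨y, rfl, x, hx, rfl⟩
    exact sub_nonneg.2 (hb.2 hx)
  have h3 := h1.dotProduct_mulVec_nonneg v
  have h4 := h2.dotProduct_mulVec_nonneg v
  simp only [star_trivial, Algebra.algebraMap_eq_smul_one, Matrix.sub_mulVec, Matrix.smul_mulVec,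
    Matrix.one_mulVec, dotProduct_sub, dotProduct_smul, smul_eq_mul, ← l2Norm_sq] at h3 h4
  constructor <;> linarith

end QuadraticForms

/-! ### Squares of sub-Gaussian variables and Bernstein's inequality -/

section SubExponential

lemma exp_le_one_add_add_sq_mul_exp_abs (x : ℝ) :
    Real.exp x ≤ 1 + x + x ^ 2 * Real.exp |x| := by
  have h := Complex.norm_exp_sub_sum_le_norm_mul_exp (x : ℂ) 2
  have e : Complex.exp x - ∑ m ∈ Finset.range 2, (x : ℂ) ^ m / m.factorial
      = ((Real.exp x - (1 + x) : ℝ) : ℂ) := by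
    simp [Finset.sum_range_succ]
  rw [e, Complex.norm_real, Complex.norm_real, Real.norm_eq_abs, Real.norm_eq_abs, sq_abs] at h
  linarith [le_abs_self (Real.exp x - (1 + x))]

lemma integrable_sq_of_subgaussian {Ω : Type*} [MeasurableSpace Ω] {P : Measure Ω} {Z : Ω → ℝ}
    {s : ℝ≥0} (hZ : HasSubgaussianMGF Z s P) :
    Integrable (fun ω => Z ω ^ 2) P := by
  have := hZ.memLp 2
  exact (memLp_two_iff_integrable_sq hZ.aestronglyMeasurable).1 (by simpa using this)

variable {Ω : Type*} [MeasurableSpace Ω] {P : Measure Ω} [IsProbabilityMeasure P] {Z : Ω → ℝ}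
  {s : ℝ≥0}

/-- The variance 1/(2s) is the one for which E exp(zg) = exp(z²/(4s)). Exchanging the integrals over
g and Z then bounds E exp(Z²/(4s)) by this value. -/
lemma lintegral_exp_sq_gaussianReal (hs : 0 < s) :
    ∫⁻ g, ENNReal.ofReal (Real.exp (s * g ^ 2 / 2)) ∂gaussianReal 0 (1 / (2 * s))
      = ENNReal.ofReal √2 := by
  have hs' : (0 : ℝ) < s := hs
  have hv : (1 / (2 * s) : ℝ≥0) ≠ 0 := by positivity
  rw [gaussianReal_of_var_ne_zero 0 hv, lintegral_withDensity_eq_lintegral_mul _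
    (measurable_gaussianPDF 0 _) (by fun_prop)]
  have e : ∀ g : ℝ, (gaussianPDF 0 (1 / (2 * s))
      * fun g => ENNReal.ofReal (Real.exp (s * g ^ 2 / 2))) g
      = ENNReal.ofReal (√(s / Real.pi) * Real.exp (-(s / 2) * g ^ 2)) := by
    intro g
    rw [Pi.mul_apply, gaussianPDF, ← ENNReal.ofReal_mul (gaussianPDFReal_nonneg _ _ _),
      gaussianPDFReal, mul_assoc, ← Real.exp_add, ← Real.sqrt_inv]
    push_cast
    congr 3
    · field_simp
    · field_simp; ring
  simp only [e]
  rw [← ofReal_integral_eq_lintegral_ofReal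
    ((integrable_exp_neg_mul_sq (by positivity)).const_mul _) (ae_of_all _ fun _ => by positivity),
    integral_const_mul, integral_gaussian, ← Real.sqrt_mul (by positivity)]
  congr 2
  field_simp

/-- A sub-Gaussian variable has an exponential square moment. -/
lemma exp_sq_moment (hs : 0 < s) (hm : Measurable Z) (hZ : HasSubgaussianMGF Z s P) :
    Integrable (fun ω => Real.exp (Z ω ^ 2 / (4 * s))) P ∧
      ∫ ω, Real.exp (Z ω ^ 2 / (4 * s)) ∂P ≤ √2 := by
  have hs' : (0 : ℝ) < s := hs
  set v : ℝ≥0 := 1 / (2 * s) with hv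
  have h1 : ∀ z : ℝ, ENNReal.ofReal (Real.exp (z ^ 2 / (4 * s)))
      = ∫⁻ g, ENNReal.ofReal (Real.exp (z * g)) ∂gaussianReal 0 v := by
    intro z
    rw [← ofReal_integral_eq_lintegral_ofReal (integrable_exp_mul_gaussianReal z)
      (ae_of_all _ fun _ => (Real.exp_pos _).le)]
    have := mgf_gaussianReal (p := gaussianReal 0 v) (X := id) (μ := 0) (v := v) (by simp) z
    simp only [mgf, id] at this
    rw [this]
    congr 2
    rw [hv]; push_cast; field_simp; ring
  have hle : ∫⁻ ω, ENNReal.ofReal (Real.exp (Z ω ^ 2 / (4 * s))) ∂P ≤ ENNReal.ofReal √2 := by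
    simp only [h1]
    rw [lintegral_lintegral_swap (by fun_prop), ← lintegral_exp_sq_gaussianReal hs]
    refine lintegral_mono fun g => ?_
    have hi := hZ.integrable_exp_mul g
    simp only [mul_comm _ g]
    rw [← ofReal_integral_eq_lintegral_ofReal hi (ae_of_all _ fun _ => (Real.exp_pos _).le)]
    exact ENNReal.ofReal_le_ofReal (hZ.mgf_le g)
  have hint : Integrable (fun ω => Real.exp (Z ω ^ 2 / (4 * s))) P := by
    refine ⟨by fun_prop, ?_⟩
    rw [hasFiniteIntegral_iff_ofReal (ae_of_all _ fun _ => (Real.exp_pos _).le)]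
    exact hle.trans_lt ENNReal.ofReal_lt_top
  refine ⟨hint, ?_⟩
  rw [← ofReal_integral_eq_lintegral_ofReal hint (ae_of_all _ fun _ => (Real.exp_pos _).le)] at hle
  exact (ENNReal.ofReal_le_ofReal_iff (by positivity)).1 hle

lemma integral_sq_le_of_subgaussian (hs : 0 < s) (hm : Measurable Z)
    (hZ : HasSubgaussianMGF Z s P) : ∫ ω, Z ω ^ 2 ∂P ≤ 2 * s := by
  have hs' : (0 : ℝ) < s := hs
  obtain ⟨h1, h2⟩ := exp_sq_moment hs hm hZ
  have h3 : ∫ ω, (Z ω ^ 2 / (4 * s) + 1) ∂P ≤ ∫ ω, Real.exp (Z ω ^ 2 / (4 * s)) ∂P :=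
    integral_mono (((integrable_sq_of_subgaussian hZ).div_const _).add (integrable_const _)) h1
      fun ω => Real.add_one_le_exp _
  rw [integral_add ((integrable_sq_of_subgaussian hZ).div_const _) (integrable_const _),
    integral_div] at h3
  simp only [integral_const, probReal_univ, smul_eq_mul, mul_one] at h3
  have h4 : √2 ≤ 3 / 2 := by rw [Real.sqrt_le_left (by norm_num)]; norm_num
  have h5 : (∫ ω, Z ω ^ 2 ∂P) / (4 * s) ≤ 1 / 2 := by linarith
  rw [div_le_iff₀ (by positivity)] at h5
  linarith

/-- The centred square of a sub-Gaussian variable is sub-exponential. -/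
lemma subexponential_sq (hs : 0 < s) (hm : Measurable Z) (hZ : HasSubgaussianMGF Z s P) {t : ℝ}
    (ht : |t| ≤ 1 / (16 * s)) :
    Integrable (fun ω => Real.exp (t * (Z ω ^ 2 - ∫ ω, Z ω ^ 2 ∂P))) P ∧
      mgf (fun ω => Z ω ^ 2 - ∫ ω, Z ω ^ 2 ∂P) P t ≤ Real.exp (1000 * t ^ 2 * s ^ 2) := by
  have hs' : (0 : ℝ) < s := hs
  obtain ⟨h1, h2⟩ := exp_sq_moment hs hm hZ
  have hsq := integrable_sq_of_subgaussian hZ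
  have hμ := integral_sq_le_of_subgaussian hs hm hZ
  have hμ0 : 0 ≤ ∫ ω, Z ω ^ 2 ∂P := integral_nonneg fun _ => sq_nonneg _
  set μ := ∫ ω, Z ω ^ 2 ∂P
  -- In the second-order expansion of exp the linear term has mean zero. The remainder uses x² ≤ 2eˣ
  -- with x = |Y|/(16s), then e^(2x) ≤ e^(1/4) exp(Z²/(4s)), with e^(1/4) ≤ 4/3.
  set D := 512 * (s : ℝ) ^ 2 * t ^ 2 * (4 / 3) with hD
  have hquarter : Real.exp (1 / 4) ≤ 4 / 3 := by
    have := Real.add_one_le_exp (-(1 / 4) : ℝ)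
    have h3 : Real.exp (1 / 4) * Real.exp (-(1 / 4)) = 1 := by rw [← Real.exp_add]; simp
    nlinarith [Real.exp_pos (1 / 4)]
  have hpt : ∀ ω, Real.exp (t * (Z ω ^ 2 - μ))
      ≤ 1 + t * (Z ω ^ 2 - μ) + D * Real.exp (Z ω ^ 2 / (4 * s)) := by
    intro ω
    set Y := Z ω ^ 2 - μ with hY
    have hYabs : |Y| ≤ Z ω ^ 2 + 2 * s := by
      rw [abs_le]; constructor <;> nlinarith [sq_nonneg (Z ω)]
    set x := |Y| / (16 * s) with hx
    have hx0 : 0 ≤ x := by positivity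
    have htY : |t * Y| ≤ x := by
      rw [abs_mul, hx, div_eq_mul_one_div, mul_comm]
      exact mul_le_mul_of_nonneg_left ht (abs_nonneg _)
    have hxe : x ^ 2 ≤ 2 * Real.exp x := by
      have := Real.quadratic_le_exp_of_nonneg hx0
      linarith
    have hY2 : Y ^ 2 = 256 * s ^ 2 * x ^ 2 := by
      rw [hx, div_pow, sq_abs]; field_simp; ring
    have hxx : Real.exp x * Real.exp x ≤ 4 / 3 * Real.exp (Z ω ^ 2 / (4 * s)) := by
      rw [← Real.exp_add]
      have : x + x ≤ 1 / 4 + Z ω ^ 2 / (4 * s) := by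
        have : x + x = |Y| / (8 * s) := by rw [hx]; field_simp; ring
        rw [this]
        have e : 1 / 4 + Z ω ^ 2 / (4 * s) = (2 * s + 2 * Z ω ^ 2) / (8 * s) := by
          field_simp; ring
        rw [e]
        gcongr
        linarith [sq_nonneg (Z ω)]
      refine (Real.exp_le_exp.2 this).trans ?_
      rw [Real.exp_add]
      gcongr
    have h3 : (t * Y) ^ 2 * Real.exp |t * Y| ≤ D * Real.exp (Z ω ^ 2 / (4 * s)) := by
      calc (t * Y) ^ 2 * Real.exp |t * Y| ≤ (t * Y) ^ 2 * Real.exp x := by gcongr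
        _ = 256 * s ^ 2 * t ^ 2 * (x ^ 2 * Real.exp x) := by rw [mul_pow, hY2]; ring
        _ ≤ 256 * s ^ 2 * t ^ 2 * (2 * Real.exp x * Real.exp x) := by gcongr
        _ = 512 * s ^ 2 * t ^ 2 * (Real.exp x * Real.exp x) := by ring
        _ ≤ 512 * s ^ 2 * t ^ 2 * (4 / 3 * Real.exp (Z ω ^ 2 / (4 * s))) := by gcongr
        _ = _ := by rw [hD]; ring
    linarith [exp_le_one_add_add_sq_mul_exp_abs (t * Y)]
  have hint0 : Integrable (fun ω => Z ω ^ 2 - μ) P := hsq.sub (integrable_const _)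
  have hint1 : Integrable (fun ω => 1 + t * (Z ω ^ 2 - μ)) P :=
    (integrable_const _).add (hint0.const_mul _)
  have hint2 : Integrable (fun ω => D * Real.exp (Z ω ^ 2 / (4 * s))) P := h1.const_mul _
  have hint : Integrable (fun ω => Real.exp (t * (Z ω ^ 2 - μ))) P := by
    refine (hint1.add hint2).mono' (by fun_prop) (ae_of_all _ fun ω => ?_)
    rw [Real.norm_eq_abs, abs_of_pos (Real.exp_pos _)]
    exact hpt ω
  refine ⟨hint, ?_⟩
  have h3 : ∫ ω, Real.exp (t * (Z ω ^ 2 - μ)) ∂P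
      ≤ ∫ ω, (1 + t * (Z ω ^ 2 - μ) + D * Real.exp (Z ω ^ 2 / (4 * s))) ∂P :=
    integral_mono hint (hint1.add hint2) hpt
  have h4 : ∫ ω, (1 + t * (Z ω ^ 2 - μ) + D * Real.exp (Z ω ^ 2 / (4 * s))) ∂P
      = 1 + D * ∫ ω, Real.exp (Z ω ^ 2 / (4 * s)) ∂P := by
    rw [integral_add hint1 hint2, integral_const_mul,
      integral_add (integrable_const _) (hint0.const_mul _),
      integral_const_mul, integral_sub hsq (integrable_const _)]
    simp [μ]
  rw [h4] at h3
  have h5 : √2 ≤ 29 / 20 := by rw [Real.sqrt_le_left (by norm_num)]; norm_num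
  have hD0 : 0 ≤ D := by positivity
  calc mgf (fun ω => Z ω ^ 2 - μ) P t ≤ 1 + D * ∫ ω, Real.exp (Z ω ^ 2 / (4 * s)) ∂P := h3
    _ ≤ 1 + D * (29 / 20) := by gcongr; exact h2.trans h5
    _ ≤ 1000 * t ^ 2 * s ^ 2 + 1 := by
        have : 0 ≤ (s : ℝ) ^ 2 * t ^ 2 := by positivity
        rw [hD]; linarith
    _ ≤ _ := Real.add_one_le_exp _

variable {ι : Type*} [Fintype ι] {Y : ι → Ω → ℝ}

lemma measure_sum_ge_le_of_mgf {t K : ℝ} (ht : 0 ≤ t) (hm : ∀ i, Measurable (Y i))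
    (hi : iIndepFun Y P) (hint : ∀ i, Integrable (fun ω => Real.exp (t * Y i ω)) P)
    (hY : ∀ i, mgf (Y i) P t ≤ Real.exp K) (δ : ℝ) :
    P.real {ω | δ ≤ ∑ i, Y i ω} ≤ Real.exp (-(t * δ) + Fintype.card ι * K) := by
  have h1 := measure_ge_le_exp_mul_mgf (μ := P) (X := ∑ i, Y i) (t := t) δ ht
    (hi.integrable_exp_mul_sum hm fun i _ => hint i)
  rw [hi.mgf_sum hm] at h1
  have h2 : ∏ i, mgf (Y i) P t ≤ Real.exp (Fintype.card ι * K) := by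
    calc ∏ i, mgf (Y i) P t ≤ ∏ _i : ι, Real.exp K :=
          Finset.prod_le_prod (fun _ _ => mgf_nonneg) fun i _ => hY i
      _ = _ := by simp [← Real.exp_nat_mul]
  simp only [Finset.sum_apply] at h1
  rw [Real.exp_add]
  refine h1.trans ?_
  rw [neg_mul]
  gcongr

/-- Bernstein's inequality for sums of squares of independent sub-Gaussian variables. -/
lemma measure_abs_sum_sq_sub_ge_le {Z : ι → Ω → ℝ} (hs : 0 < s) (hm : ∀ i, Measurable (Z i))
    (hi : iIndepFun Z P) (hZ : ∀ i, HasSubgaussianMGF (Z i) s P) [Nonempty ι] {δ : ℝ}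
    (hδ0 : 0 ≤ δ) (hδ : δ ≤ 125 * (Fintype.card ι * s)) :
    P.real {ω | δ ≤ |∑ i, (Z i ω ^ 2 - ∫ ω, Z i ω ^ 2 ∂P)|}
      ≤ 2 * Real.exp (-(δ ^ 2 / (4000 * (Fintype.card ι * s ^ 2)))) := by
  have hs' : (0 : ℝ) < s := hs
  have hN : (0 : ℝ) < Fintype.card ι := by exact_mod_cast Fintype.card_pos
  set N : ℝ := (Fintype.card ι : ℝ) with hNdef
  -- Minimizer of −tδ + 1000Nt²s²; the upper bound on `δ` is exactly what keeps t ≤ 1/(16s).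
  set t := δ / (2000 * (N * s ^ 2)) with ht
  have ht0 : 0 ≤ t := by positivity
  have ht1 : t ≤ 1 / (16 * s) := by
    rw [ht, div_le_div_iff₀ (by positivity) (by positivity)]
    nlinarith
  set Y : ι → Ω → ℝ := fun i ω => Z i ω ^ 2 - ∫ ω, Z i ω ^ 2 ∂P with hY
  have hYm : ∀ i, Measurable (Y i) := fun i => ((hm i).pow_const 2).sub_const _
  have hYi : iIndepFun Y P :=
    hi.comp (fun i x => x ^ 2 - ∫ ω, Z i ω ^ 2 ∂P) fun i => by fun_prop
  have hexp : -(t * δ) + N * (1000 * t ^ 2 * s ^ 2) = -(δ ^ 2 / (4000 * (N * s ^ 2))) := by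
    rw [ht]; field_simp; ring
  have h1 : P.real {ω | δ ≤ ∑ i, Y i ω} ≤ Real.exp (-(δ ^ 2 / (4000 * (N * s ^ 2)))) := by
    rw [← hexp]
    have hb : ∀ i, _ := fun i => subexponential_sq hs (hm i) (hZ i) (t := t)
      (by rwa [abs_of_nonneg ht0])
    exact measure_sum_ge_le_of_mgf ht0 hYm hYi (fun i => (hb i).1) (fun i => (hb i).2) δ
  have h2 : P.real {ω | δ ≤ ∑ i, (-Y i) ω} ≤ Real.exp (-(δ ^ 2 / (4000 * (N * s ^ 2)))) := by
    rw [← hexp]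
    have hb : ∀ i, _ := fun i => subexponential_sq hs (hm i) (hZ i) (t := -t)
      (by rwa [abs_neg, abs_of_nonneg ht0])
    refine measure_sum_ge_le_of_mgf (Y := fun i => -Y i) ht0 (fun i => (hYm i).neg)
      (hYi.comp (fun _ x => -x) fun _ => measurable_neg) (fun i => ?_) (fun i => ?_) δ
    · simpa only [hY, Pi.neg_apply, neg_mul, mul_neg] using (hb i).1
    · rw [mgf_neg]; simpa using (hb i).2
  have hsub : {ω | δ ≤ |∑ i, Y i ω|} ⊆ {ω | δ ≤ ∑ i, Y i ω} ∪ {ω | δ ≤ ∑ i, (-Y i) ω} := by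
    intro ω hω
    simp only [Set.mem_ofPred_eq, Set.mem_union, Pi.neg_apply, Finset.sum_neg_distrib] at hω ⊢
    exact le_abs.1 hω
  calc P.real {ω | δ ≤ |∑ i, Y i ω|} ≤ _ := measureReal_mono hsub
    _ ≤ _ := measureReal_union_le _ _
    _ ≤ _ := by linarith

lemma measure_abs_ge_le_of_subgaussian (hZ : HasSubgaussianMGF Z s P) {r : ℝ} (hr : 0 ≤ r) :
    P.real {ω | r ≤ |Z ω|} ≤ 2 * Real.exp (-(r ^ 2) / (2 * s)) := by
  have hsub : {ω | r ≤ |Z ω|} ⊆ {ω | r ≤ Z ω} ∪ {ω | r ≤ (-Z) ω} := by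
    intro ω hω
    exact le_abs.1 (show r ≤ |Z ω| from hω)
  calc P.real {ω | r ≤ |Z ω|} ≤ _ := measureReal_mono hsub
    _ ≤ _ := measureReal_union_le _ _
    _ ≤ _ := by linarith [hZ.measure_ge_le hr, hZ.neg.measure_ge_le hr]

end SubExponential

/-! ### Concentration of the clean Gram matrix -/

section RandomMatrix

variable {Ω : Type*} [MeasurableSpace Ω] {P : Measure Ω} {m p : ℕ}
  {X : Ω → Matrix (Fin m) (Fin p) ℝ} {S : Matrix (Fin p) (Fin p) ℝ} {s : ℝ≥0}

lemma dotProduct_gram_sub_mulVec {m p : ℕ} (X : Matrix (Fin m) (Fin p) ℝ)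
    (S : Matrix (Fin p) (Fin p) ℝ) (u : Fin p → ℝ) :
    u ⬝ᵥ ((Xᵀ * X - (m : ℝ) • S) *ᵥ u) = ∑ i, ((u ⬝ᵥ X i) ^ 2 - u ⬝ᵥ (S *ᵥ u)) := by
  have h : u ⬝ᵥ ((Xᵀ * X) *ᵥ u) = ∑ i, (u ⬝ᵥ X i) ^ 2 := by
    rw [← Matrix.mulVec_mulVec, Matrix.dotProduct_mulVec, Matrix.vecMul_transpose]
    simp only [dotProduct, Matrix.mulVec, pow_two]
    refine Finset.sum_congr rfl fun i _ => ?_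
    simp only [mul_comm (u _)]
  rw [Matrix.sub_mulVec, dotProduct_sub, h, Matrix.smul_mulVec, dotProduct_smul]
  simp

lemma l2Norm_single (a : Fin p) : l2Norm (Pi.single a (1 : ℝ)) = 1 := by
  have h := l2Norm_sq (Pi.single a (1 : ℝ))
  simp only [single_dotProduct, Pi.single_eq_same, mul_one] at h
  have := l2Norm_nonneg (Pi.single a (1 : ℝ))
  nlinarith

lemma IsSubGaussianMatrix.subGaussian_entry (hX : IsSubGaussianMatrix P X S s) (i : Fin m)
    (a : Fin p) : HasSubgaussianMGF (fun ω => X ω i a) s P := by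
  simpa using hX.subGaussian i (Pi.single a 1) (l2Norm_single a)

lemma IsSubGaussianMatrix.measurable_entry (hX : IsSubGaussianMatrix P X S s) (i : Fin m)
    (a : Fin p) : Measurable fun ω => X ω i a :=
  (measurable_pi_apply a).comp (hX.measurable_row i)

lemma measurable_dotProduct_left (u : Fin p → ℝ) : Measurable fun x : Fin p → ℝ => u ⬝ᵥ x := by
  unfold dotProduct; fun_prop

lemma IsSubGaussianMatrix.measurable_dotProduct (hX : IsSubGaussianMatrix P X S s) (i : Fin m)
    (u : Fin p → ℝ) : Measurable fun ω => u ⬝ᵥ X ω i :=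
  (measurable_dotProduct_left u).comp (hX.measurable_row i)

lemma IsSubGaussianMatrix.isSymm (hX : IsSubGaussianMatrix P X S s) (i : Fin m) : S.IsSymm := by
  ext a b
  rw [Matrix.transpose_apply, ← hX.covariance_eq i, ← hX.covariance_eq i, covariance_comm]

/-- The event of uniform concentration of the Gram matrix over sums of signed basis vectors,
together with boundedness of the entries. -/
def goodEvent (X : Ω → Matrix (Fin m) (Fin p) ℝ) (S : Matrix (Fin p) (Fin p) ℝ) (k : ℕ)
    (δ r : ℝ) : Set Ω :=
  {ω | (∀ g : Fin (k + 1) → Fin p × Bool,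
      |signedSum g ⬝ᵥ (((X ω)ᵀ * X ω - (m : ℝ) • S) *ᵥ signedSum g)|
        ≤ δ * l2Norm (signedSum g) ^ 2) ∧ ∀ i a, |X ω i a| ≤ r}

lemma IsSubGaussianMatrix.measurableSet_goodEvent (hX : IsSubGaussianMatrix P X S s) (k : ℕ)
    (δ r : ℝ) : MeasurableSet (goodEvent X S k δ r) := by
  have h1 : ∀ u : Fin p → ℝ,
      Measurable fun ω => u ⬝ᵥ (((X ω)ᵀ * X ω - (m : ℝ) • S) *ᵥ u) := by
    intro u
    simp only [dotProduct_gram_sub_mulVec]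
    exact Finset.measurable_sum _ fun i _ =>
      ((hX.measurable_dotProduct i u).pow_const 2).sub_const _
  have e : goodEvent X S k δ r = (⋂ g : Fin (k + 1) → Fin p × Bool,
      {ω | |signedSum g ⬝ᵥ (((X ω)ᵀ * X ω - (m : ℝ) • S) *ᵥ signedSum g)|
        ≤ δ * l2Norm (signedSum g) ^ 2}) ∩ ⋂ i, ⋂ a, {ω | |X ω i a| ≤ r} := by
    ext ω
    simp only [goodEvent, Set.mem_inter_iff, Set.mem_iInter, Set.mem_ofPred_eq]
  rw [e]
  exact (MeasurableSet.iInter fun g => measurableSet_le (h1 _).abs measurable_const).inter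
    (MeasurableSet.iInter fun i => MeasurableSet.iInter fun a =>
      measurableSet_le (hX.measurable_entry i a).abs measurable_const)

variable [IsProbabilityMeasure P]

lemma IsSubGaussianMatrix.integral_sq (hX : IsSubGaussianMatrix P X S s) (i : Fin m)
    (u : Fin p → ℝ) : ∫ ω, (u ⬝ᵥ X ω i) ^ 2 ∂P = u ⬝ᵥ (S *ᵥ u) := by
  have hL : ∀ a, MemLp (fun ω => X ω i a) 2 P := fun a => by
    simpa using (hX.subGaussian_entry i a).memLp 2
  have hint : ∀ a b, Integrable (fun ω => X ω i a * X ω i b) P := fun a b =>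
    (hL a).integrable_mul (hL b)
  have hcov : ∀ a b, ∫ ω, X ω i a * X ω i b ∂P = S a b := by
    intro a b
    have := hX.covariance_eq i a b
    rw [covariance_eq_sub (hL a) (hL b), hX.mean_zero, hX.mean_zero] at this
    simpa using this
  have e : ∀ ω, (u ⬝ᵥ X ω i) ^ 2 = ∑ a, ∑ b, u a * u b * (X ω i a * X ω i b) := by
    intro ω
    simp only [dotProduct, pow_two, Finset.sum_mul_sum]
    exact Finset.sum_congr rfl fun a _ => Finset.sum_congr rfl fun b _ => by ring
  simp only [e]
  rw [integral_finsetSum _ fun a _ => integrable_finsetSum _ fun b _ => (hint a b).const_mul _]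
  simp only [dotProduct, Matrix.mulVec, Finset.mul_sum]
  refine Finset.sum_congr rfl fun a _ => ?_
  rw [integral_finsetSum _ fun b _ => (hint a b).const_mul _]
  refine Finset.sum_congr rfl fun b _ => ?_
  rw [integral_const_mul, hcov]
  ring

/-- The second moment of a normalized projection is at most 2s. This yields λ_min ≤ 2σ_x², which
keeps the deviation level in Bernstein's range. -/
lemma IsSubGaussianMatrix.quadraticForm_le (hX : IsSubGaussianMatrix P X S s) (hs : 0 < s)
    (i : Fin m) (v : Fin p → ℝ) : v ⬝ᵥ (S *ᵥ v) ≤ 2 * s * l2Norm v ^ 2 := by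
  rcases eq_or_ne (l2Norm v) 0 with h0 | h0
  · have : v = 0 := by
      have h := l2Norm_sq v
      rw [h0] at h
      exact dotProduct_self_eq_zero.1 (by simpa using h.symm)
    simp [this, l2Norm_sq]
  · set r := l2Norm v with hr
    have hr0 : 0 < r := (l2Norm_nonneg v).lt_of_ne' h0
    have hu : l2Norm (r⁻¹ • v) = 1 := by
      rw [l2Norm_smul, abs_of_pos (inv_pos.2 hr0), ← hr, inv_mul_cancel₀ h0]
    have h1 := integral_sq_le_of_subgaussian hs (hX.measurable_dotProduct i _)
      (hX.subGaussian i _ hu)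
    rw [hX.integral_sq, Matrix.mulVec_smul, smul_dotProduct, dotProduct_smul, smul_eq_mul,
      smul_eq_mul] at h1
    have h2 : v ⬝ᵥ (S *ᵥ v) = r ^ 2 * (r⁻¹ * (r⁻¹ * v ⬝ᵥ (S *ᵥ v))) := by field_simp
    rw [h2, mul_comm]
    gcongr

/-- Concentration of the Gram matrix along one direction. -/
lemma IsSubGaussianMatrix.measure_quadraticForm_le (hX : IsSubGaussianMatrix P X S s)
    (hs : 0 < s) (hm : 0 < m) {δ : ℝ} (hδ0 : 0 ≤ δ) (hδ : δ ≤ 125 * (m * s)) (f : Fin p → ℝ) :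
    P.real {ω | δ * l2Norm f ^ 2 < |f ⬝ᵥ (((X ω)ᵀ * X ω - (m : ℝ) • S) *ᵥ f)|}
      ≤ 2 * Real.exp (-(δ ^ 2 / (4000 * (m * s ^ 2)))) := by
  rcases eq_or_ne (l2Norm f) 0 with h0 | h0
  · have : f = 0 := by
      have h := l2Norm_sq f
      rw [h0] at h
      exact dotProduct_self_eq_zero.1 (by simpa using h.symm)
    simp [this, l2Norm_sq]
    positivity
  · set r := l2Norm f with hr
    have hr0 : 0 < r := (l2Norm_nonneg f).lt_of_ne' h0
    set u := r⁻¹ • f with hu'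
    have hu : l2Norm u = 1 := by
      rw [l2Norm_smul, abs_of_pos (inv_pos.2 hr0), ← hr, inv_mul_cancel₀ h0]
    have hf : f = r • u := by rw [hu', smul_smul, mul_inv_cancel₀ h0, one_smul]
    have : Nonempty (Fin m) := ⟨⟨0, hm⟩⟩
    have h1 := measure_abs_sum_sq_sub_ge_le (P := P) (Z := fun i ω => u ⬝ᵥ X ω i) hs
      (fun i => hX.measurable_dotProduct i u)
      (hX.indep_rows.comp (fun _ x => u ⬝ᵥ x) fun _ => measurable_dotProduct_left u)
      (fun i => hX.subGaussian i u hu) hδ0 (by simpa using hδ)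
    rw [Fintype.card_fin] at h1
    refine (measureReal_mono fun ω hω => ?_).trans h1
    simp only [Set.mem_ofPred_eq, hX.integral_sq] at hω ⊢
    rw [← dotProduct_gram_sub_mulVec]
    rw [hf, Matrix.mulVec_smul, smul_dotProduct, dotProduct_smul, smul_eq_mul, smul_eq_mul,
      ← mul_assoc, abs_mul, ← pow_two, abs_of_nonneg (sq_nonneg r), mul_comm] at hω
    exact (lt_of_mul_lt_mul_left hω (sq_nonneg r)).le

lemma IsSubGaussianMatrix.measure_compl_goodEvent_le (hX : IsSubGaussianMatrix P X S s)
    (hs : 0 < s) (hm : 0 < m) (k : ℕ) {δ r : ℝ} (hδ0 : 0 ≤ δ) (hδ : δ ≤ 125 * (m * s))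
    (hr : 0 ≤ r) :
    P.real (goodEvent X S k δ r)ᶜ
      ≤ (p * 2) ^ (k + 1) * (2 * Real.exp (-(δ ^ 2 / (4000 * (m * s ^ 2)))))
        + m * (p * (2 * Real.exp (-(r ^ 2) / (2 * s)))) := by
  have hsub : (goodEvent X S k δ r)ᶜ ⊆
      (⋃ g : Fin (k + 1) → Fin p × Bool, {ω | δ * l2Norm (signedSum g) ^ 2
        < |signedSum g ⬝ᵥ (((X ω)ᵀ * X ω - (m : ℝ) • S) *ᵥ signedSum g)|}) ∪
      ⋃ x : Fin m × Fin p, {ω | r ≤ |X ω x.1 x.2|} := by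
    intro ω hω
    simp only [goodEvent, Set.mem_compl_iff, Set.mem_ofPred_eq, not_and_or, not_forall,
      not_le] at hω
    rcases hω with ⟨g, hg⟩ | ⟨i, a, h⟩
    · exact Or.inl (Set.mem_iUnion.2 ⟨g, hg⟩)
    · exact Or.inr (Set.mem_iUnion.2 ⟨(i, a), h.le⟩)
  refine (measureReal_mono hsub).trans ((measureReal_union_le _ _).trans (add_le_add ?_ ?_))
  · refine (measureReal_iUnion_fintype_le _).trans ?_
    refine (Finset.sum_le_sum fun g _ =>
      hX.measure_quadraticForm_le hs hm hδ0 hδ (signedSum g)).trans (le_of_eq ?_)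
    simp
  · refine (measureReal_iUnion_fintype_le _).trans ?_
    refine (Finset.sum_le_sum fun x _ =>
      measure_abs_ge_le_of_subgaussian (hX.subGaussian_entry x.1 x.2) hr).trans (le_of_eq ?_)
    simp [mul_assoc]

end RandomMatrix

/-! ### Effect of corruption on the surrogate covariance -/

section RestrictedEigenvalues

variable {m p : ℕ}

/-- Trimming bounds the effect of corrupted rows on the Gram matrix entrywise. -/
lemma abs_trimmedInner_sub_gram_le {h : ℕ} {A B : Matrix (Fin m) (Fin p) ℝ} {r : ℝ} (hr : 0 ≤ r)
    (hB : ∀ i a, |B i a| ≤ r) (hAB : IsCorruption h B A) (a b : Fin p) :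
    |trimmedInner h (fun i => A i a) (fun i => A i b) - (Bᵀ * B) a b| ≤ 3 * (h * r ^ 2) := by
  classical
  rw [Matrix.mul_apply]
  refine abs_trimmedInner_sub_sum_le (sq_nonneg r) (fun i => ?_) ?_
  · rw [Matrix.transpose_apply, abs_mul, pow_two]
    exact mul_le_mul (hB i a) (hB i b) (abs_nonneg _) hr
  · refine le_trans ?_ hAB
    rw [← Set.ncard_coe_finset]
    refine Set.ncard_le_ncard (fun i hi (he : A i = B i) => ?_) (Set.toFinite _)
    rw [Finset.mem_coe, Finset.mem_filter] at hi
    exact hi.2 (by rw [he, Matrix.transpose_apply])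

lemma dotProduct_GammaHat_mulVec {h : ℕ} (α : ℝ) (A : Matrix (Fin m) (Fin p) ℝ) (v : Fin p → ℝ) :
    v ⬝ᵥ (GammaHat α h A *ᵥ v)
      = α * (v ⬝ᵥ ((Matrix.of fun a b => trimmedInner h (fun i => A i a) fun i => A i b) *ᵥ v))
        + (1 - α) * l2Norm v ^ 2 := by
  have e : GammaHat α h A = α • (Matrix.of fun a b => trimmedInner h (fun i => A i a) fun i => A i b)
      + (1 - α) • (1 : Matrix (Fin p) (Fin p) ℝ) := by
    ext a b; simp [GammaHat]
  rw [e, Matrix.add_mulVec, Matrix.smul_mulVec, Matrix.smul_mulVec, Matrix.one_mulVec,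
    dotProduct_add, dotProduct_smul, dotProduct_smul, l2Norm_sq, smul_eq_mul, smul_eq_mul]

end RestrictedEigenvalues

/-! ### The high-probability event and the choice of constants -/

section Assembly

/-- Deviation of the trimmed Gram matrix from the population covariance as a quadratic form. -/
lemma abs_trimmedGram_sub_le {n no p k : ℕ} (hn : 0 < n) (hk : 0 < k)
    {A B : Matrix (Fin (n + no)) (Fin p) ℝ} {S : Matrix (Fin p) (Fin p) ℝ} {δ r K : ℝ}
    (hr : 0 ≤ r) (hB : ∀ i a, |B i a| ≤ r) (hAB : IsCorruption no B A)
    (hg : ∀ g : Fin (k + 1) → Fin p × Bool,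
      |signedSum g ⬝ᵥ ((Bᵀ * B - ((n + no : ℕ) : ℝ) • ((1 / (n : ℝ)) • S)) *ᵥ signedSum g)|
        ≤ δ * l2Norm (signedSum g) ^ 2)
    {v : Fin p → ℝ} (hS : |v ⬝ᵥ (S *ᵥ v)| ≤ K * l2Norm v ^ 2) :
    |v ⬝ᵥ ((Matrix.of fun a b => trimmedInner no (fun i => A i a) fun i => A i b) *ᵥ v)
        - v ⬝ᵥ (S *ᵥ v)|
      ≤ (δ + no / n * K) * l2Norm v ^ 2 + (2 * δ / k + 3 * (no * r ^ 2)) * l1Norm v ^ 2 := by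
  set T : Matrix (Fin p) (Fin p) ℝ :=
    Matrix.of fun a b => trimmedInner no (fun i => A i a) fun i => A i b with hT
  have hn' : (n : ℝ) ≠ 0 := by positivity
  set M := Bᵀ * B - ((n + no : ℕ) : ℝ) • ((1 / (n : ℝ)) • S) with hM
  have h1 : |v ⬝ᵥ ((T - Bᵀ * B) *ᵥ v)| ≤ 3 * (no * r ^ 2) * l1Norm v ^ 2 :=
    abs_dotProduct_mulVec_le (fun a b => abs_trimmedInner_sub_gram_le hr hB hAB a b) v
  have h2 := abs_dotProduct_mulVec_le_of_signedSum hk hg v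
  -- The clean Gram matrix has n + n_o rows of covariance S/n, hence mean (1 + n_o/n)S; the excess
  -- is the last term.
  have e : T - S = (T - Bᵀ * B) + M + ((no : ℝ) / n) • S := by
    have : ((no : ℝ) / n) • S = ((n + no : ℕ) : ℝ) • ((1 / (n : ℝ)) • S) - S := by
      rw [smul_smul]
      nth_rw 3 [← one_smul ℝ S]
      rw [← sub_smul]
      congr 1
      push_cast; field_simp; ring
    rw [this, hM]; abel
  have e2 : v ⬝ᵥ (T *ᵥ v) - v ⬝ᵥ (S *ᵥ v)
      = v ⬝ᵥ ((T - Bᵀ * B) *ᵥ v) + v ⬝ᵥ (M *ᵥ v) + no / n * (v ⬝ᵥ (S *ᵥ v)) := by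
    rw [← dotProduct_sub, ← Matrix.sub_mulVec, e, Matrix.add_mulVec, Matrix.add_mulVec,
      dotProduct_add, dotProduct_add, Matrix.smul_mulVec, dotProduct_smul, smul_eq_mul]
  have h3 : |(no : ℝ) / n * (v ⬝ᵥ (S *ᵥ v))| ≤ no / n * (K * l2Norm v ^ 2) := by
    rw [abs_mul, abs_of_nonneg (by positivity : (0 : ℝ) ≤ no / n)]
    gcongr
  rw [e2]
  calc _ ≤ |v ⬝ᵥ ((T - Bᵀ * B) *ᵥ v)| + |v ⬝ᵥ (M *ᵥ v)| + |(no : ℝ) / n * (v ⬝ᵥ (S *ᵥ v))| :=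
        abs_add_three _ _ _
    _ ≤ 3 * (no * r ^ 2) * l1Norm v ^ 2 + δ * (l2Norm v ^ 2 + 2 * l1Norm v ^ 2 / k)
        + no / n * (K * l2Norm v ^ 2) := add_le_add (add_le_add h1 h2) h3
    _ = _ := by ring

/-- Numerical bound on the failure probability. -/
lemma failure_probability_le {p m k : ℕ} {x y : ℝ} (hp : 2 ≤ p) (hk : 0 < k) (hm : m ≤ 2 * p)
    (hx : 16 * (k * Real.log p) ≤ x) (hy : 16 * Real.log p ≤ y) :
    ((p : ℝ) * 2) ^ (k + 1) * (2 * Real.exp (-x)) + m * (p * (2 * Real.exp (-y)))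
      ≤ 1 / (p : ℝ) ^ 2 := by
  have hp' : (2 : ℝ) ≤ p := by exact_mod_cast hp
  have hp0 : (0 : ℝ) < p := by linarith
  have h1 : Real.exp (-x) ≤ ((p : ℝ) ^ (16 * k))⁻¹ := by
    rw [← Real.exp_log (pow_pos hp0 (16 * k)), ← Real.exp_neg, Real.log_pow]
    refine Real.exp_le_exp.2 (neg_le_neg ?_)
    push_cast; linarith
  have h2 : Real.exp (-y) ≤ ((p : ℝ) ^ 16)⁻¹ := by
    rw [← Real.exp_log (pow_pos hp0 16), ← Real.exp_neg, Real.log_pow]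
    refine Real.exp_le_exp.2 (neg_le_neg ?_)
    push_cast; linarith
  have h3 : ((p : ℝ) * 2) ^ (k + 1) ≤ (p : ℝ) ^ (4 * k) := by
    calc ((p : ℝ) * 2) ^ (k + 1) ≤ ((p : ℝ) * p) ^ (k + 1) := by gcongr
      _ = (p : ℝ) ^ (2 * (k + 1)) := by rw [← pow_two, ← pow_mul]
      _ ≤ (p : ℝ) ^ (4 * k) := pow_le_pow_right₀ (by linarith) (by omega)
  have hm' : (m : ℝ) ≤ p * p := by
    have : (m : ℝ) ≤ 2 * p := by exact_mod_cast hm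
    nlinarith
  have h4 : ((p : ℝ) * 2) ^ (k + 1) * (2 * Real.exp (-x)) ≤ ((p : ℝ) ^ 3)⁻¹ := by
    calc ((p : ℝ) * 2) ^ (k + 1) * (2 * Real.exp (-x))
        ≤ (p : ℝ) ^ (4 * k) * (p * ((p : ℝ) ^ (16 * k))⁻¹) := by gcongr
      _ ≤ ((p : ℝ) ^ 3)⁻¹ := by
        rw [← mul_assoc, ← pow_succ, ← div_eq_mul_inv, div_le_iff₀ (by positivity),
          ← div_eq_inv_mul, le_div_iff₀ (by positivity), ← pow_add]
        exact pow_le_pow_right₀ (by linarith) (by omega)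
  have h5 : m * (p * (2 * Real.exp (-y))) ≤ ((p : ℝ) ^ 3)⁻¹ := by
    calc m * (p * (2 * Real.exp (-y))) ≤ p * p * (p * (p * ((p : ℝ) ^ 16)⁻¹)) := by gcongr
      _ = ((p : ℝ) ^ 12)⁻¹ := by field_simp
      _ ≤ ((p : ℝ) ^ 3)⁻¹ := by
        gcongr
        · linarith
        · norm_num
  have h6 : ((p : ℝ) ^ 3)⁻¹ + ((p : ℝ) ^ 3)⁻¹ ≤ 1 / (p : ℝ) ^ 2 := by
    have : ((p : ℝ) ^ 3)⁻¹ + ((p : ℝ) ^ 3)⁻¹ = 2 / p * (1 / (p : ℝ) ^ 2) := by field_simp; ring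
    rw [this]
    refine mul_le_of_le_one_left (by positivity) ?_
    rw [div_le_one hp0]; exact hp'
  linarith

/-- Restricted strong convexity and smoothness of the robust surrogate, from closeness of the
trimmed Gram matrix to the population covariance. -/
lemma restricted_curvature {q m h : ℕ} {α a b τ : ℝ} (h0 : 0 ≤ α) (h1 : α ≤ 1) (ha : 0 < a)
    (hab : a ≤ b) {A : Matrix (Fin m) (Fin q) ℝ} {S : Matrix (Fin q) (Fin q) ℝ} {v : Fin q → ℝ}
    (hS : a * l2Norm v ^ 2 ≤ v ⬝ᵥ (S *ᵥ v) ∧ v ⬝ᵥ (S *ᵥ v) ≤ b * l2Norm v ^ 2)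
    (hT : |v ⬝ᵥ ((Matrix.of fun a b => trimmedInner h (fun i => A i a) fun i => A i b) *ᵥ v)
        - v ⬝ᵥ (S *ᵥ v)| ≤ a / 1000 * l2Norm v ^ 2 + τ * l1Norm v ^ 2) :
    (α * (a / 2) + (1 - α)) * l2Norm v ^ 2 - α * τ * l1Norm v ^ 2 ≤ v ⬝ᵥ (GammaHat α h A *ᵥ v) ∧
      v ⬝ᵥ (GammaHat α h A *ᵥ v) ≤ 2 * mu2 α b * l2Norm v ^ 2 + α * τ * l1Norm v ^ 2 := by
  rw [dotProduct_GammaHat_mulVec, mu2]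
  obtain ⟨h2, h3⟩ := abs_le.1 hT
  have hv := sq_nonneg (l2Norm v)
  generalize v ⬝ᵥ ((Matrix.of fun a b => trimmedInner h (fun i => A i a) fun i => A i b) *ᵥ v) = Q
    at *
  have hav := mul_nonneg ha.le hv
  have habv := mul_le_mul_of_nonneg_right hab hv
  -- There is ample slack: the deviation is only a/1000, while a/2 is given away below and at least
  -- 2b above.
  have h4 : a / 2 * l2Norm v ^ 2 - τ * l1Norm v ^ 2 ≤ Q := by linarith [hS.1]
  have h5 : Q ≤ 3 * b * l2Norm v ^ 2 + τ * l1Norm v ^ 2 := by linarith [hS.2]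
  have h6 := mul_le_mul_of_nonneg_left h4 h0
  have h7 := mul_le_mul_of_nonneg_left h5 h0
  have h8 := mul_nonneg (sub_nonneg.2 h1) hv
  constructor <;> linarith

/-- High-probability closeness of the trimmed Gram matrix to the population covariance. -/
lemma exists_event_trimmedGram {n p k no : ℕ} {σ : ℝ≥0} {a : ℝ} {S : Matrix (Fin p) (Fin p) ℝ}
    {Ω : Type*} [MeasurableSpace Ω] {P : Measure Ω} [IsProbabilityMeasure P]
    {X₀ X : Ω → Matrix (Fin (n + no)) (Fin p) ℝ} (hn : 0 < n) (hnp : n ≤ p) (hk : 0 < k)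
    (hkp : k < p) (ha : 0 < a) (hS : ∀ v, a * l2Norm v ^ 2 ≤ v ⬝ᵥ (S *ᵥ v))
    (hsize : 2048000000000 * ((σ : ℝ) ^ 4 / a ^ 2 * k * Real.log p) ≤ n)
    (hout : (no : ℝ) / n ≤ 1 / 1000000 * (a / ((σ : ℝ) ^ 2 * k * Real.log p)))
    (hX : IsSubGaussianMatrix P X₀ ((1 / (n : ℝ)) • S) (σ ^ 2 / n))
    (hc : ∀ ω, IsCorruption no (X₀ ω) (X ω)) :
    ∃ E : Set Ω, MeasurableSet E ∧ 1 - 1 / (p : ℝ) ^ 2 ≤ P.real E ∧ ∀ ω ∈ E, ∀ v,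
      |v ⬝ᵥ ((Matrix.of fun a b => trimmedInner no (fun i => X ω i a) fun i => X ω i b) *ᵥ v)
        - v ⬝ᵥ (S *ᵥ v)| ≤ a / 1000 * l2Norm v ^ 2 + a / (1000 * k) * l1Norm v ^ 2 := by
  have hn' : (0 : ℝ) < n := by exact_mod_cast hn
  have hk' : (1 : ℝ) ≤ k := by exact_mod_cast hk
  have hp2 : 2 ≤ p := by omega
  have hp' : (2 : ℝ) ≤ p := by exact_mod_cast hp2
  have hlog : 1 / 2 ≤ Real.log p := by
    have h1 := Real.log_two_gt_d9
    have h2 := Real.log_le_log (by norm_num) hp'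
    linarith
  set L := Real.log p with hL
  have hL0 : 0 < L := by linarith
  have hN : 0 < n + no := by omega
  let i0 : Fin (n + no) := ⟨0, hN⟩
  let a0 : Fin p := ⟨0, by omega⟩
  -- Were σ zero, the entries of the clean rows would vanish almost surely, contradicting λ_min > 0.
  have hσ : 0 < σ := by
    rcases eq_or_ne σ 0 with h | h
    · have h1 := hX.subGaussian_entry i0 a0
      have hz : ((σ ^ 2 / n : ℝ≥0)) = 0 := by simp [h]
      rw [hz] at h1
      have h2 := hX.integral_sq i0 (Pi.single a0 1)
      have h3 : ∫ ω, (Pi.single a0 (1 : ℝ) ⬝ᵥ X₀ ω i0) ^ 2 ∂P = 0 := by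
        have : (fun ω => (Pi.single a0 (1 : ℝ) ⬝ᵥ X₀ ω i0) ^ 2) =ᵐ[P] 0 := by
          filter_upwards [h1.ae_eq_zero_of_hasSubgaussianMGF_zero] with ω hω
          simp only [single_dotProduct, one_mul]
          simp only [Pi.zero_apply] at hω ⊢
          rw [hω]; simp
        rw [integral_congr_ae this]; simp
      have h4 := hS (Pi.single a0 1)
      rw [l2Norm_single] at h4
      rw [h3, Matrix.smul_mulVec, dotProduct_smul, smul_eq_mul] at h2
      have : 0 < 1 / (n : ℝ) * (Pi.single a0 1 ⬝ᵥ (S *ᵥ Pi.single a0 1)) := by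
        apply mul_pos (by positivity); linarith
      linarith
    · exact pos_iff_ne_zero.2 h
  have hσ' : (0 : ℝ) < σ := hσ
  set s : ℝ≥0 := σ ^ 2 / n with hs
  have hs0 : 0 < s := by positivity
  have hsr : (s : ℝ) = (σ : ℝ) ^ 2 / n := by rw [hs]; push_cast; rfl
  have hup : ∀ v, v ⬝ᵥ (S *ᵥ v) ≤ 2 * (σ : ℝ) ^ 2 * l2Norm v ^ 2 := by
    intro v
    have h1 := hX.quadraticForm_le hs0 i0 v
    rw [Matrix.smul_mulVec, dotProduct_smul, smul_eq_mul, hsr] at h1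
    have h2 := mul_le_mul_of_nonneg_left h1 hn'.le
    have e1 : (n : ℝ) * (1 / n * v ⬝ᵥ (S *ᵥ v)) = v ⬝ᵥ (S *ᵥ v) := by field_simp
    have e2 : (n : ℝ) * (2 * ((σ : ℝ) ^ 2 / n) * l2Norm v ^ 2) = 2 * (σ : ℝ) ^ 2 * l2Norm v ^ 2 := by
      field_simp
    rwa [e1, e2] at h2
  have haσ : a ≤ 2 * (σ : ℝ) ^ 2 := by
    have h1 := hS (Pi.single a0 1)
    have h2 := hup (Pi.single a0 1)
    rw [l2Norm_single] at h1 h2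
    linarith
  have hout2 : (no : ℝ) / n * ((σ : ℝ) ^ 2 * k * L) ≤ a / 1000000 := by
    have h1 : 0 < (σ : ℝ) ^ 2 * k * L := by positivity
    rw [mul_div_assoc', le_div_iff₀ h1] at hout
    linarith
  have hq0 : 0 ≤ (no : ℝ) / n := by positivity
  have hout3 : (no : ℝ) / n * (σ : ℝ) ^ 2 ≤ a / 500000 := by
    have h2 : (1 : ℝ) / 2 ≤ k * L := by nlinarith
    have h3 := mul_le_mul_of_nonneg_left h2 (mul_nonneg hq0 (sq_nonneg (σ : ℝ)))
    linarith
  have hno : no ≤ n := by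
    have h1 : (no : ℝ) / n ≤ 1 := by
      by_contra! h
      have := mul_lt_mul_of_pos_right h (pow_pos hσ' 2)
      linarith
    rw [div_le_one hn'] at h1
    exact_mod_cast h1
  set δ := a / 4000 with hδ
  -- Chosen so that each entry exceeds `r` with probability at most 2p⁻¹⁶.
  set r := √(32 * (s * L)) with hr
  have hr2 : r ^ 2 = 32 * (s * L) := Real.sq_sqrt (by positivity)
  have hNn : (n : ℝ) ≤ (n + no : ℕ) ∧ ((n + no : ℕ) : ℝ) ≤ 2 * n := by
    constructor
    · exact_mod_cast Nat.le_add_right n no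
    · exact_mod_cast (by omega : n + no ≤ 2 * n)
  have hns : (n : ℝ) * s = (σ : ℝ) ^ 2 := by rw [hsr]; field_simp
  have hδ1 : δ ≤ 125 * ((n + no : ℕ) * s) := by
    have h1 := mul_le_mul_of_nonneg_right hNn.1 s.2
    have h2 : (σ : ℝ) ^ 2 ≤ (n + no : ℕ) * s := hns ▸ h1
    rw [hδ]; linarith
  have hδ0 : 0 ≤ δ := by positivity
  refine ⟨goodEvent X₀ ((1 / (n : ℝ)) • S) k δ r, hX.measurableSet_goodEvent k δ r, ?_, ?_⟩
  · have h1 := hX.measure_compl_goodEvent_le hs0 hN k hδ0 hδ1 (Real.sqrt_nonneg _ : 0 ≤ r)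
    rw [probReal_compl_eq_one_sub (hX.measurableSet_goodEvent k δ r)] at h1
    rw [neg_div] at h1
    have h2 := h1.trans (failure_probability_le hp2 hk (by omega) ?_ ?_)
    · linarith
    · rw [le_div_iff₀ (by positivity)]
      have h3 : ((n + no : ℕ) : ℝ) * s ^ 2 ≤ 2 * (σ : ℝ) ^ 4 / n := by
        calc ((n + no : ℕ) : ℝ) * s ^ 2 ≤ 2 * n * s ^ 2 := by gcongr; exact hNn.2
          _ = _ := by rw [hsr]; field_simp
      -- The constant is 128000 · 4000²: the first factor is 16 · 4000 · 2 from the exponent, the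
      -- second comes from δ = a/4000.
      have h4 : 2048000000000 * ((σ : ℝ) ^ 4 * k * L) ≤ n * a ^ 2 := by
        have e : 2048000000000 * ((σ : ℝ) ^ 4 * k * L)
            = 2048000000000 * ((σ : ℝ) ^ 4 / a ^ 2 * k * L) * a ^ 2 := by field_simp
        rw [e]; gcongr
      calc 16 * (k * L) * (4000 * ((n + no : ℕ) * s ^ 2))
          ≤ 16 * (k * L) * (4000 * (2 * (σ : ℝ) ^ 4 / n)) := by gcongr
        _ = 128000 * ((σ : ℝ) ^ 4 * k * L) / n := by ring
        _ ≤ δ ^ 2 := by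
          rw [div_le_iff₀ hn', hδ]
          linarith
    · rw [hr2, le_div_iff₀ (by positivity)]
      linarith
  · intro ω hω v
    have hSabs : |v ⬝ᵥ (S *ᵥ v)| ≤ 2 * (σ : ℝ) ^ 2 * l2Norm v ^ 2 := by
      rw [abs_of_nonneg ((mul_nonneg ha.le (sq_nonneg _)).trans (hS v))]
      exact hup v
    refine (abs_trimmedGram_sub_le hn hk (Real.sqrt_nonneg _) hω.2 (hc ω) hω.1 hSabs).trans ?_
    have h1 : δ + (no : ℝ) / n * (2 * (σ : ℝ) ^ 2) ≤ a / 1000 := by rw [hδ]; linarith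
    have h2 : 2 * δ / k + 3 * (no * r ^ 2) ≤ a / (1000 * k) := by
      -- The Maurey term and the corruption term both scale as 1/k; 96 = 3 · 32 comes from r².
      have e : 2 * δ / k + 3 * (no * r ^ 2)
          = (a / 2000 + 96 * (no / n * ((σ : ℝ) ^ 2 * k * L))) / k := by
        rw [hr2, hsr, hδ]; field_simp; ring
      have e2 : a / (1000 * k) = a / 1000 / k := by field_simp
      rw [e, e2]
      gcongr
      linarith
    gcongr

end Assembly

end REN

theorem theorem2 (d : ℕ) :
    ∃ C > (0 : ℝ), ∃ c > (0 : ℝ), ∃ c₁ > (0 : ℝ),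
    ∀ α lmin lmax : ℝ, 0 ≤ α → α ≤ 1 → 0 < lmin →
    ∃ γ : ℝ, 0 < γ ∧ γ < 1 ∧
    ∀ (n p k no : ℕ) (σx σε : ℝ≥0) (S : Matrix (Fin p) (Fin p) ℝ) (βstar : Fin p → ℝ),
    -- dimensions and sparsity of the parameter
    0 < n → n ≤ p → 0 < k → k < p →
    {j | βstar j ≠ 0}.ncard ≤ k →
    -- extreme eigenvalues of the covariance matrix
    IsLeast (spectrum ℝ S) lmin → IsGreatest (spectrum ℝ S) lmax →
    -- sample size, outlier fraction, sparsity of the columns of the covariance matrix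
    C * ((σx : ℝ) ^ 4 / lmin ^ 2 * k * Real.log p) ≤ n →
    (no : ℝ) / n ≤ c * (lmin / ((σx : ℝ) ^ 2 * k * Real.log p)) →
    (∀ b, {a | S a b ≠ 0}.ncard ≤ d) →
    ∀ (Ω : Type*) [MeasurableSpace Ω] (P : Measure Ω) [IsProbabilityMeasure P]
      -- data before corruption
      (X₀ : Ω → Matrix (Fin (n + no)) (Fin p) ℝ) (ε : Ω → Fin (n + no) → ℝ)
      -- observed data
      (X : Ω → Matrix (Fin (n + no)) (Fin p) ℝ) (y : Ω → Fin (n + no) → ℝ),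
    REN.IsSubGaussianMatrix P X₀ ((1 / (n : ℝ)) • S) (σx ^ 2 / n) →
    REN.IsSubGaussianNoise P X₀ ε (σε ^ 2 / n) →
    (∀ ω, REN.IsCorruption no (X₀ ω) (X ω)) →
    (∀ ω, REN.IsCorruption no (X₀ ω *ᵥ βstar + ε ω) (y ω)) →
    ∃ E : Set Ω, MeasurableSet E ∧ 1 - 1 / (p : ℝ) ^ 2 ≤ P.real E ∧
      ∀ ω ∈ E, ∀ (βhat : Fin p → ℝ) (β : ℕ → Fin p → ℝ),
        REN.IsSolution (REN.GammaHat α no (X ω)) (REN.gammaHat no (X ω) (y ω))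
          (REN.l1Norm βstar) βhat →
        REN.IsProjGradDescent (REN.GammaHat α no (X ω)) (REN.gammaHat no (X ω) (y ω))
          (REN.l1Norm βstar) (2 * REN.mu2 α lmax) β →
        ∀ t : ℕ,
          REN.l2Norm (β t - βhat) ^ 2
              ≤ γ ^ t * REN.l2Norm (β 0 - βhat) ^ 2
                + c₁ * (Real.log p / n) * REN.l1Norm (βhat - βstar) ^ 2
                + REN.l2Norm (βhat - βstar) ^ 2 ∧
          REN.l1Norm (β t - βhat)
              ≤ 2 * Real.sqrt k * REN.l2Norm (β t - βhat)
                + 2 * Real.sqrt k * REN.l2Norm (βhat - βstar)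
                + 2 * REN.l1Norm (βhat - βstar) := by
  refine ⟨2048000000000, by norm_num, 1 / 1000000, by norm_num, 1, one_pos, ?_⟩
  intro α a b h0 h1 ha
  -- `γ` is chosen before any matrix is given, so b < a must be treated; the eigenvalue hypotheses
  -- then contradict each other.
  rcases lt_or_ge b a with hba | hab
  · refine ⟨1 / 2, by norm_num, by norm_num, ?_⟩
    intro n p k no σx σε S βstar _ _ _ _ _ hmin hmax
    exact absurd (hmin.2 hmax.1) (not_le.2 hba)
  set η := 2 * REN.mu2 α b with hη
  set μ := α * (a / 2) + (1 - α) with hμ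
  have hμ0 : 0 < μ := by
    rcases h0.eq_or_lt with h | h
    · rw [hμ, ← h]; norm_num
    · have := mul_pos h ha
      rw [hμ]; linarith
  have hμη : μ ≤ η := by
    have := mul_le_mul_of_nonneg_left hab h0
    have := mul_nonneg h0 ha.le
    rw [hη, hμ, REN.mu2]; linarith
  have hden : 0 < η + 19 / 20 * μ := by linarith
  refine ⟨(η - 19 / 20 * μ) / (η + 19 / 20 * μ), div_pos (by linarith) hden,
    (div_lt_one hden).2 (by linarith), ?_⟩
  intro n p k no σx σε S βstar hn hnp hk hkp hsp hmin hmax hsize hout _ Ω _ P _ X₀ ε X y hX _ hc _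
  have hk' : (0 : ℝ) < k := by exact_mod_cast hk
  have hS : S.IsSymm := by
    have h := hX.isSymm ⟨0, by omega⟩
    have hn' : (n : ℝ) ≠ 0 := by positivity
    ext i j
    have := congrFun (congrFun h i) j
    simpa [hn'] using this
  have hray := REN.rayleigh_bounds hS hmin hmax
  obtain ⟨E, hE, hPE, hgood⟩ := REN.exists_event_trimmedGram hn hnp hk hkp ha
    (fun v => (hray v).1) hsize hout hX hc
  refine ⟨E, hE, hPE, fun ω hω βhat β hsol hβ t => ?_⟩
  have hcurv := fun v => REN.restricted_curvature h0 h1 ha hab (hray v) (hgood ω hω v)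
  -- 480/1000 is just below the 1/2 kept in the lower curvature.
  have hτ : 480 * (k * (α * (a / (1000 * k)))) ≤ μ := by
    have e : 480 * (k * (α * (a / (1000 * k)))) = 480 / 1000 * (α * a) := by field_simp
    have := mul_nonneg h0 ha.le
    rw [e, hμ]; linarith
  obtain ⟨h2, h3⟩ := REN.projGrad_convergence hμ0 hμη (by positivity) hτ
    (REN.isSymm_GammaHat α (X ω)) (fun v => (hcurv v).1) (fun v => (hcurv v).2) hsp hsol hβ t
  -- The deterministic bound is already stronger: the log p / n term and the second copy of the ℓ₁
  -- error are only added for free.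
  have h4 : 0 ≤ 1 * (Real.log p / n) * REN.l1Norm (βhat - βstar) ^ 2 := by
    have : 0 ≤ Real.log p := Real.log_natCast_nonneg p
    positivity
  have h5 := REN.l1Norm_nonneg (βhat - βstar)
  exact ⟨by linarith, by linarith⟩
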